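/- **Lemma (Equivalence of the tangential parts).** Let $n\ge 1$ and let $\Gamma_*=\Gamma^1_*\cup\Gamma^2_*\cup\Gamma^3_*\subset\mathbb{R}^{n+1}$ be a double bubble: the $\Gamma^i_*$ are three compact spherical caps (or flat $n$-balls) with a common boundary, the round $(n-1)$-sphere $\Sigma_*$, along which they meet at angles $\theta^1,\theta^2,\theta^3\in(0,\pi)$ with $\theta^1+\theta^2+\theta^3=2\pi$, where $\theta^k$ is the angle between $\Gamma^i_*$ and $\Gamma^j_*$, $\{i,j,k\}=\{1,2,3\}$ (for the standard double bubble, $\theta^i=2\pi/3$), and $\Gamma^1_*$ lies between $\Gamma^2_*$ and $\Gamma^3_*$. Let $\nu^i_*$ be the outer unit conormals. Let $N^i_*$ be the unit normals such that $N^1_*$ points into the region $\Omega_{12}$ enclosed by $\Gamma^1_*\cup\Gamma^2_*$, $N^2_*$ points out of $\Omega_{12}$ and $N^3_*$ points into the region enclosed by $\Gamma^1_*\cup\Gamma^3_*$, or let all three be reversed. With $s^i=\sin\theta^i$, $c^i=\cos\theta^i$ put $$\mathcal{T}=\begin{pmatrix}0 & \frac{c^2}{s^1} & -\frac{c^3}{s^1}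 \\ -\frac{c^1}{s^2} & 0 & \frac{c^3}{s^2} \\ \frac{c^1}{s^3} & -\frac{c^2}{s^3} & 0 \end{pmatrix}.$$ Let $B$ be the closed unit ball of $\mathbb{R}^n$ and let $\varphi_i:B\to\Gamma^i_*$ ($i=1,2,3$) be $C^\infty$-parametrizations up to the boundary (smooth bijective immersions with $\varphi_i(\partial B)=\Sigma_*$) such that $\varphi_1=\varphi_2=\varphi_3$ on $\partial B$. Let $\tau^i_*$ be smooth tangential vector fields on $\Gamma^i_*$ with $\tau^i_*=\nu^i_*$ on $\Sigma_*$ whose (closed) support consists of points that have a unique nearest point $\mathrm{pr}_\Sigma$ on $\Sigma_*$. For $k\ge2$ let $C^k_{TJ}(\Gamma_*)=C^k(\Gamma^1_*)\times C^k(\Gamma^2_*)\times C^k(\Gamma^3_*)$ (functions that are $C^k$ up to the boundary, with the $C^k$-norm taken in the parametrizations $\varphi_i$) and $$C^k_{TJ,0}(\Gamma_*)=\{\boldsymbol\rho\in C^k_{TJ}(\Gamma_*) : \rho^i=0\text{ on }\Sigma_*,\ i=1,2,3\}.$$ For $\boldsymbol\rho=(\rho^1,\rho^2,\rho^3)$ define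 the nonlocal and the local tangential parts $$\mu^i_{DGK}(\boldsymbol\rho)(\sigma)=\sum_j\mathcal{T}_{ij}\,\rho^j(\mathrm{pr}_\Sigma(\sigma)),\qquad \mu^i_{G}(\boldsymbol\rho)(\sigma)=\sum_j\mathcal{T}_{ij}\,\rho^j\big(\varphi_j(\varphi_i^{-1}(\sigma))\big),\qquad\sigma\in\Gamma^i_*$$ (the first is needed only on the support of $\tau^i_*$). For $\boldsymbol\mu=(\mu^1,\mu^2,\mu^3)$ let $\Gamma_{\boldsymbol\rho,\boldsymbol\mu}$ be the triple of the sets $\Gamma^i_{\boldsymbol\rho,\boldsymbol\mu}=\{\sigma+\rho^i(\sigma)N^i_*(\sigma)+\mu^i(\sigma)\tau^i_*(\sigma):\sigma\in\Gamma^i_*\}$, $i=1,2,3$. Then for every $k\ge 2$ there exist $r,r'>0$ and a map $$\bar F: C^k_{TJ}(\Gamma_*)\supset B_r(0)\to B_{r'}(0)\subset C^k_{TJ,0}(\Gamma_*)$$ such that $F=\mathrm{Id}+\bar F$ satisfies, for all $\boldsymbol\rho\in B_r(0)$, $$\Gamma_{\boldsymbol\rho,\mu_{DGK}(\boldsymbol\rho)}=\Gamma_{F(\boldsymbol\rho),\mu_G(F(\boldsymbol\rho))},$$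 that is, equality of the $i$-th hypersurfaces for each $i=1,2,3$. -/

import Mathlib

noncomputable section

namespace TripleJunction

open scoped ContDiff

/-- The ambient space `ℝ^{n+1}` of an `n`-dimensional double bubble. -/
abbrev Amb (n : ℕ) : Type := EuclideanSpace ℝ (Fin (n + 1))

/-- The parameter space `ℝ^n`. -/
abbrev Par (n : ℕ) : Type := EuclideanSpace ℝ (Fin n)

/-- The closed unit ball of `ℝ^n`. -/
abbrev unitBall (n : ℕ) : Set (Par n) := Metric.closedBall 0 1

/-- A double bubble in `ℝ^{n+1}`: three spherical caps (or flat balls) with a common boundary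
`(n-1)`-sphere, which has centre `c` and radius `r` and lies in the hyperplane through `c`
orthogonal to the unit vector `a`, meeting there at the angles `θ 0, θ 1, θ 2` in `(0, π)` with sum
`2π`, where `θ k` is the angle between the two hypersurfaces different from the `k`-th one.
(The standard double bubble is the case in which every `θ k` is `2π/3`.)

The indices `0, 1, 2` in the code stand for the customary `1, 2, 3`.
The hypersurface number `0` is the one between the other two; `α` is the angle of its outer conormal
against the radial direction of the boundary sphere. The two conditions on `α` say that the angles
of all three outer conormals are in `(-π, π)`, which means that all three are caps or
flat balls. The sign `o` fixes which of the two compatible orientations of the normals is used. -/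
structure DoubleBubble (n : ℕ) where
  c : Amb n
  a : Amb n
  r : ℝ
  θ : Fin 3 → ℝ
  α : ℝ
  o : ℝ
  norm_a : ‖a‖ = 1
  r_pos : 0 < r
  θ_pos : ∀ i, 0 < θ i
  θ_lt : ∀ i, θ i < Real.pi
  θ_sum : θ 0 + θ 1 + θ 2 = 2 * Real.pi
  α_gt : -Real.pi < α - θ 1
  α_lt : α + θ 2 < Real.pi
  o_sign : o = 1 ∨ o = -1

variable {n : ℕ}

namespace DoubleBubble

variable (D : DoubleBubble n)

/-- The triple junction `Σ_*`, an `(n-1)`-sphere. -/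
def Sig : Set (Amb n) := {x | ‖x - D.c‖ = D.r ∧ inner ℝ D.a (x - D.c) = 0}

/-- The angles in `(-π, π)` of the three outer conormals at the triple junction. -/
def ang : Fin 3 → ℝ := ![D.α, D.α + D.θ 2, D.α - D.θ 1]

/-- The cap with boundary `Σ_*` whose outer conormal has the angle `β ∈ (-π, π)`: a flat ball
if `β = 0`, and otherwise the part of the sphere with centre `c + r cot β a` and radius
`r / |sin β|` (which passes through `Σ_*`) on that side of the hyperplane of `Σ_*` from which
the conormal points away. -/
def cap (β : ℝ) : Set (Amb n) :=
  if β = 0 then {x | ‖x - D.c‖ ≤ D.r ∧ inner ℝ D.a (x - D.c) = 0}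
  else {x | ‖x - (D.c + (D.r * (Real.cos β / Real.sin β)) • D.a)‖ = D.r / |Real.sin β| ∧
    inner ℝ D.a (x - D.c) * Real.sin β ≤ 0}

/-- The three hypersurfaces `Γ^i_*` (with their boundary `Σ_*`). -/
def Gam (i : Fin 3) : Set (Amb n) := D.cap (D.ang i)

/-- The outer unit conormal of `Γ^i_*` at the points `x` of `Σ_*`. -/
def conormal (i : Fin 3) (x : Amb n) : Amb n :=
  (Real.cos (D.ang i) / D.r) • (x - D.c) + Real.sin (D.ang i) • D.a

/-- The unit normal of `Γ^i_*` at the points `x` of `Γ^i_*`. For `o = 1` the normal of the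
middle surface `Γ^1_*` points into the volume `Ω_12` between `Γ^1_*` and `Γ^2_*`, that of `Γ^2_*`
points out of `Ω_12`, and that of `Γ^3_*` points into the volume `Ω_13` between `Γ^1_*` and `Γ^3_*`.
For `o = -1` all three are reversed. -/
def normal (i : Fin 3) (x : Amb n) : Amb n :=
  D.o • ((Real.sin (D.ang i) / D.r) • (x - D.c) - Real.cos (D.ang i) • D.a)

/-- The matrix `𝒯`. -/
def T : Matrix (Fin 3) (Fin 3) ℝ :=
  !![0, Real.cos (D.θ 1) / Real.sin (D.θ 0), -(Real.cos (D.θ 2) / Real.sin (D.θ 0));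
     -(Real.cos (D.θ 0) / Real.sin (D.θ 1)), 0, Real.cos (D.θ 2) / Real.sin (D.θ 1);
     Real.cos (D.θ 0) / Real.sin (D.θ 2), -(Real.cos (D.θ 1) / Real.sin (D.θ 2)), 0]

/-- Triples `ρ = (ρ^1, ρ^2, ρ^3)` of real functions `ρ^i` on `Γ^i_*`. -/
abbrev Fun : Type := ∀ i : Fin 3, D.Gam i → ℝ

/-- The value `ρ^i(x)` for points `x` of `ℝ^{n+1}`, with the dummy value `0` off `Γ^i_*`. -/
def val (ρ : D.Fun) (i : Fin 3) (x : Amb n) : ℝ :=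
  Function.extend (Subtype.val : D.Gam i → Amb n) (ρ i) (fun _ => 0) x

/-- `p` is a point of `Σ_*` with least distance from `x`. -/
def IsNearest (x p : Amb n) : Prop := p ∈ D.Sig ∧ ∀ q ∈ D.Sig, dist x p ≤ dist x q

/-- The projection to the nearest point of `Σ_*`
(an arbitrary nearest point where it is not unique). -/
def pr (x : Amb n) : Amb n := Classical.epsilon (D.IsNearest x)

/-- The nonlocal tangential part `μ_DGK(ρ)^i = (𝒯 ρ)^i ∘ pr_Σ`. -/
def muDGK (ρ : D.Fun) : D.Fun := fun i σ => D.T.mulVec (fun j => D.val ρ j (D.pr σ.1)) i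

end DoubleBubble

/-- The auxiliary data over a double bubble: the parametrizations `φ^i` of the `Γ^i_*` over one unit
ball, and the tangential vector fields `τ^i_*`. Only the values of `φ i` on the closed unit ball and
those of `τ i` on `Γ^i_*` matter. -/
structure Frame (D : DoubleBubble n) where
  φ : Fin 3 → Par n → Amb n
  τ : Fin 3 → Amb n → Amb n
  φ_smooth : ∀ i, ContDiffOn ℝ ∞ (φ i) (unitBall n)
  φ_immersion : ∀ i, ∀ x ∈ unitBall n,
    Function.Injective (fderivWithin ℝ (φ i) (unitBall n) x)
  φ_bij : ∀ i, Set.BijOn (φ i) (unitBall n) (D.Gam i)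
  φ_boundary : ∀ i, φ i '' Metric.sphere 0 1 = D.Sig
  φ_junction : ∀ i j, ∀ x ∈ Metric.sphere (0 : Par n) 1, φ i x = φ j x
  τ_smooth : ∀ i, ContDiffOn ℝ ∞ (τ i ∘ φ i) (unitBall n)
  τ_tangent : ∀ i, ∀ x ∈ D.Gam i, inner ℝ (τ i x) (D.normal i x) = 0
  τ_conormal : ∀ i, ∀ x ∈ D.Sig, τ i x = D.conormal i x
  /-- The support of `τ^i_*` lies where the projection to `Σ_*` is well-defined. -/
  τ_support : ∀ i, ∀ x ∈ closure {x | x ∈ D.Gam i ∧ τ i x ≠ 0}, ∃! p, D.IsNearest x p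

namespace Frame

variable {D : DoubleBubble n} (P : Frame D)

/-- `ρ^i` in the parametrization `φ^i`. -/
def pull (ρ : D.Fun) (i : Fin 3) : Par n → ℝ := fun x => D.val ρ i (P.φ i x)

/-- The space `C^k_TJ(Γ_*) = C^k(Γ^1_*) × C^k(Γ^2_*) × C^k(Γ^3_*)`, all functions being `C^k` up to
the boundary. -/
def CkTJ (k : ℕ) : Set D.Fun := {ρ | ∀ i, ContDiffOn ℝ k (P.pull ρ i) (unitBall n)}

/-- The subspace `C^k_{TJ,0}(Γ_*)` of the functions that vanish on `Σ_*`. -/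
def CkTJ0 (k : ℕ) : Set D.Fun := {ρ | ρ ∈ P.CkTJ k ∧ ∀ i, ∀ x : D.Gam i, x.1 ∈ D.Sig → ρ i x = 0}

/-- The norm of `C^k_TJ(Γ_*)`, in the parametrizations `φ^i`: the sum over `i = 1, 2, 3` and
`j = 0, …, k` of the sup-norm of the `j`-th derivative. -/
def normCk (k : ℕ) (ρ : D.Fun) : ℝ :=
  ∑ i : Fin 3, ∑ j ∈ Finset.range (k + 1),
    ⨆ x : unitBall n, ‖iteratedFDerivWithin ℝ j (P.pull ρ i) (unitBall n) x.1‖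

/-- The open ball `B_s(0)` of `C^k_TJ(Γ_*)`. -/
def ball (k : ℕ) (s : ℝ) : Set D.Fun := {ρ | ρ ∈ P.CkTJ k ∧ P.normCk k ρ < s}

/-- The open ball `B_s(0)` of `C^k_{TJ,0}(Γ_*)`. -/
def ball0 (k : ℕ) (s : ℝ) : Set D.Fun := {ρ | ρ ∈ P.CkTJ0 k ∧ P.normCk k ρ < s}

/-- The inverse `Γ^i_* → B` of the parametrization `φ^i`. -/
def φInv (i : Fin 3) : Amb n → Par n := Function.invFunOn (P.φ i) (unitBall n)

/-- The local tangential part `μ_G(ρ)^i = (𝒯 (ρ^1 ∘ φ^1, ρ^2 ∘ φ^2, ρ^3 ∘ φ^3))^i ∘ (φ^i)⁻¹`. -/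
def muG (ρ : D.Fun) : D.Fun := fun i σ => D.T.mulVec (fun j => P.pull ρ j (P.φInv i σ.1)) i

/-- The map `Φ^i_{ρ,μ}(σ) = σ + ρ^i(σ) N^i_*(σ) + μ^i(σ) τ^i_*(σ)` on `Γ^i_*`. -/
def Phi (ρ μ : D.Fun) (i : Fin 3) (σ : D.Gam i) : Amb n :=
  σ.1 + ρ i σ • D.normal i σ.1 + μ i σ • P.τ i σ.1

/-- The cluster `Γ_{ρ,μ}`, as the triple of the hypersurfaces `Γ^i_{ρ,μ} = Φ^i_{ρ,μ}(Γ^i_*)`. -/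
def cluster (ρ μ : D.Fun) : Fin 3 → Set (Amb n) := fun i => Set.range (P.Phi ρ μ i)

end Frame

end TripleJunction

end

/-!
The two descriptions are compared in the parametrizations over the unit ball `B`. Given `ρ` in the
ball of radius `r`, let `Φ_i = φ_i + r e_i`, with `e_i` depending linearly on `ρ / r`, be the
parametrization of the `i`-th hypersurface of the nonlocal description.
A triple `u` of functions on `B` has a local description of the same hypersurfaces if there are
displacements `ξ_i : B → ℝ^n`, for which `y ↦ y + ξ_i(y)` maps `B` onto itself, with
`Φ_i (y + ξ_i(y)) = φ_i(y) + u_i(y) N_i(y) + (𝒯 u)_i(y) τ_i(y)` for `i = 1, 2, 3`.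
At each `y` this is a system of `3 (n + 1)` equations for the `3 (n + 1)` numbers
`Z = (ξ_i, u_i)_i`. It is local, since `𝒯` acts on the values at one parameter `y`, and for `ρ = 0`
it has the solution `Z = 0`, where the linearization is invertible: the normal components of
`Dφ_i ξ_i - u_i N_i - (𝒯 u)_i τ_i` are the `-u_i`, and the `φ_i` are immersions
(`Frame.lin_isInvertible`). Hence the Newton map is a contraction for small `ρ`.

On the sphere the solution is `ξ_i = 0`, `u = ρ`, since the projection to `Σ_*` is the identity on
`Σ_*` (`Frame.newton_add_pert_boundary`). This keeps the `ξ_i` in the ball without an extension of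
the data beyond it: the iteration is first made well-defined by the radial retraction of `y + ξ_i`
to `B`; its fixed points are Lipschitz in `y` with a small constant and zero on the sphere, so
`‖ξ_i(y)‖ ≤ (1 - ‖y‖) / 2`, and the retraction did nothing (`exists_fixedPoint_displ`). The same two
facts show that `y ↦ y + ξ_i(y)` is onto (`exists_add_eq_of_lipschitz`), and `u - ρ` vanishes on the
sphere.

Differentiation of the fixed point equation shows that `Z` is as smooth as the data, with bounds of
all derivatives up to order `k` that are uniform in `ρ` (`UnifCk.of_fixedPoint`); this gives `r'`.
The data `e_i` are uniformly `C^k` because the nearest-point projection is smooth off the axis of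
`Σ_*`, thus near the supports of the `τ_i` (`Frame.exists_footPar`).
-/

noncomputable section

namespace TripleJunction

open scoped ContDiff
open Set Filter Topology Asymptotics

/-! ### Families of maps with uniformly bounded derivatives -/

section UnifCk

variable {ι : Type} {E F G H : Type} [NormedAddCommGroup E] [NormedSpace ℝ E]
  [NormedAddCommGroup F] [NormedSpace ℝ F] [NormedAddCommGroup G] [NormedSpace ℝ G]
  [NormedAddCommGroup H] [NormedSpace ℝ H]

/-- The maps `f i` are `C^m` on `s`, and their derivatives of order at most `m` are bounded on `s`
by a constant that does not depend on `i`. -/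
def UnifCk (m : ℕ) (f : ι → E → F) (s : Set E) : Prop :=
  (∀ i, ContDiffOn ℝ m (f i) s) ∧
    ∃ C : ℝ, ∀ i, ∀ j ≤ m, ∀ x ∈ s, ‖iteratedFDerivWithin ℝ j (f i) s x‖ ≤ C

namespace UnifCk

variable {m : ℕ} {s : Set E} {f : ι → E → F}

theorem of_le {m' : ℕ} (h : UnifCk m f s) (hm : m' ≤ m) : UnifCk m' f s :=
  ⟨fun i => (h.1 i).of_le (by exact_mod_cast hm),
    h.2.imp fun _ hC i j hj => hC i j (hj.trans hm)⟩

theorem congr {g : ι → E → F} (h : UnifCk m f s) (hfg : ∀ i, EqOn (g i) (f i) s) :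
    UnifCk m g s := by
  refine ⟨fun i => (h.1 i).congr (hfg i), h.2.imp fun C hC i j hj x hx => ?_⟩
  rw [iteratedFDerivWithin_congr (hfg i) hx]
  exact hC i j hj x hx

theorem exists_pos_bound (h : UnifCk m f s) :
    ∃ C : ℝ, 1 ≤ C ∧ ∀ i, ∀ j ≤ m, ∀ x ∈ s, ‖iteratedFDerivWithin ℝ j (f i) s x‖ ≤ C := by
  obtain ⟨C, hC⟩ := h.2
  exact ⟨max C 1, le_max_right _ _, fun i j hj x hx => (hC i j hj x hx).trans (le_max_left _ _)⟩

theorem zero_of (hc : ∀ i, ContinuousOn (f i) s) {C : ℝ} (hb : ∀ i, ∀ x ∈ s, ‖f i x‖ ≤ C) :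
    UnifCk 0 f s :=
  ⟨fun i => by simpa using hc i, C, fun i j hj x hx => by
    obtain rfl : j = 0 := by omega
    simpa using hb i x hx⟩

theorem succ_of (hs : UniqueDiffOn ℝ s) (hd : ∀ i, DifferentiableOn ℝ (f i) s) {C : ℝ}
    (hb : ∀ i, ∀ x ∈ s, ‖f i x‖ ≤ C) (h : UnifCk m (fun i => fderivWithin ℝ (f i) s) s) :
    UnifCk (m + 1) f s := by
  obtain ⟨C', hC'⟩ := h.2
  refine ⟨fun i => ?_, max C C', fun i j hj x hx => ?_⟩
  · have := (contDiffOn_succ_iff_fderivWithin (n := (m : ℕ∞ω)) hs).2 ⟨hd i, by simp, h.1 i⟩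
    exact_mod_cast this
  · rcases j with _ | j
    · simpa using (hb i x hx).trans (le_max_left _ _)
    · rw [← norm_iteratedFDerivWithin_fderivWithin hs hx]
      exact (hC' i j (by omega) x hx).trans (le_max_right _ _)

theorem fderivWithin_of_succ (hs : UniqueDiffOn ℝ s) (h : UnifCk (m + 1) f s) :
    UnifCk m (fun i => fderivWithin ℝ (f i) s) s := by
  obtain ⟨C, hC⟩ := h.2
  refine ⟨fun i => ((h.1 i).fderivWithin hs (by simp)), C, fun i j hj x hx => ?_⟩
  rw [norm_iteratedFDerivWithin_fderivWithin hs hx]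
  exact hC i (j + 1) (by omega) x hx

theorem comp {g : ι → F → G} {t : Set F} (hg : UnifCk m g t) (hf : UnifCk m f s)
    (ht : UniqueDiffOn ℝ t) (hs : UniqueDiffOn ℝ s) (hst : ∀ i, MapsTo (f i) s t) :
    UnifCk m (fun i x => g i (f i x)) s := by
  obtain ⟨C, -, hC⟩ := hg.exists_pos_bound
  obtain ⟨D, hD1, hD⟩ := hf.exists_pos_bound
  refine ⟨fun i => (hg.1 i).comp (hf.1 i) (hst i), (m.factorial * max C 0 * D ^ m),
    fun i j hj x hx => ?_⟩
  have := norm_iteratedFDerivWithin_comp_le (hg.1 i) (hf.1 i) (n := j) (by exact_mod_cast hj)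
    ht hs (hst i) hx (C := max C 0) (D := D)
    (fun l hl => (hC i l (hl.trans hj) _ (hst i hx)).trans (le_max_left _ _))
    (fun l hl1 hl => (hD i l (hl.trans hj) x hx).trans (le_self_pow₀ hD1 (by omega)))
  refine this.trans ?_
  gcongr

theorem clm_comp (L : F →L[ℝ] G) (hs : UniqueDiffOn ℝ s) (h : UnifCk m f s) :
    UnifCk m (fun i x => L (f i x)) s := by
  obtain ⟨C, -, hC⟩ := h.exists_pos_bound
  refine ⟨fun i => L.contDiff.comp_contDiffOn (h.1 i), ‖L‖ * C, fun i j hj x hx => ?_⟩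
  refine (L.norm_iteratedFDerivWithin_comp_left (h.1 i x hx) hs hx
    (by exact_mod_cast hj)).trans ?_
  gcongr
  exact hC i j hj x hx

theorem bilin (L : F →L[ℝ] G →L[ℝ] H) {g : ι → E → G} (hs : UniqueDiffOn ℝ s)
    (hf : UnifCk m f s) (hg : UnifCk m g s) : UnifCk m (fun i x => L (f i x) (g i x)) s := by
  obtain ⟨C, hC1, hC⟩ := hf.exists_pos_bound
  obtain ⟨D, hD1, hD⟩ := hg.exists_pos_bound
  refine ⟨fun i => L.isBoundedBilinearMap.contDiff.comp_contDiffOn ((hf.1 i).prodMk (hg.1 i)),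
    ‖L‖ * (2 ^ m * C * D), fun i j hj x hx => ?_⟩
  refine (L.norm_iteratedFDerivWithin_le_of_bilinear (hf.1 i) (hg.1 i) hs hx
    (by exact_mod_cast hj)).trans ?_
  gcongr
  calc _ ≤ ∑ l ∈ Finset.range (j + 1), (j.choose l : ℝ) * C * D := by
        refine Finset.sum_le_sum fun l hl => ?_
        have hl' : l ≤ j := Nat.lt_succ_iff.1 (Finset.mem_range.1 hl)
        gcongr
        · exact hC i l (hl'.trans hj) x hx
        · exact hD i (j - l) ((Nat.sub_le _ _).trans hj) x hx
    _ = 2 ^ j * C * D := by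
        rw [← Finset.sum_mul, ← Finset.sum_mul]
        congr 2
        exact_mod_cast Nat.sum_range_choose j
    _ ≤ _ := by
        gcongr
        norm_num

theorem add {g : ι → E → F} (hs : UniqueDiffOn ℝ s) (hf : UnifCk m f s) (hg : UnifCk m g s) :
    UnifCk m (fun i x => f i x + g i x) s := by
  obtain ⟨C, -, hC⟩ := hf.exists_pos_bound
  obtain ⟨D, -, hD⟩ := hg.exists_pos_bound
  refine ⟨fun i => (hf.1 i).add (hg.1 i), C + D, fun i j hj x hx => ?_⟩
  have hj' : (j : ℕ∞ω) ≤ m := by exact_mod_cast hj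
  rw [fun_iteratedFDerivWithin_add_apply ((hf.1 i x hx).of_le hj') ((hg.1 i x hx).of_le hj') hs hx]
  exact (norm_add_le _ _).trans (add_le_add (hC i j hj x hx) (hD i j hj x hx))

theorem sum {κ : Type} (S : Finset κ) {g : κ → ι → E → F} (hs : UniqueDiffOn ℝ s)
    (hg : ∀ a ∈ S, UnifCk m (g a) s) : UnifCk m (fun i x => ∑ a ∈ S, g a i x) s := by
  classical
  induction S using Finset.induction_on with
  | empty =>
    refine ⟨fun i => by simpa using contDiffOn_const, 0, fun i j hj x hx => ?_⟩
    simp [iteratedFDerivWithin_fun_zero]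
  | insert a S ha ih =>
    simp only [Finset.sum_insert ha]
    exact (hg a (by simp)).add hs (ih fun b hb => hg b (by simp [hb]))

theorem prodMk {g : ι → E → G} (hs : UniqueDiffOn ℝ s) (hf : UnifCk m f s) (hg : UnifCk m g s) :
    UnifCk m (fun i x => (f i x, g i x)) s :=
  ((hf.clm_comp (ContinuousLinearMap.inl ℝ F G) hs).add hs
    (hg.clm_comp (ContinuousLinearMap.inr ℝ F G) hs)).congr fun i x _ => by simp

theorem pi {κ : Type} [Fintype κ] [DecidableEq κ] {g : ι → E → κ → F} (hs : UniqueDiffOn ℝ s)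
    (hg : ∀ a, UnifCk m (fun i x => g i x a) s) : UnifCk m g s := by
  refine (UnifCk.sum Finset.univ hs fun a _ =>
    (hg a).clm_comp (ContinuousLinearMap.single ℝ (fun _ : κ => F) a) hs).congr fun i x _ => ?_
  simp [Finset.univ_sum_single]

/-- On a compact set a single `C^m` map is a bounded family. -/
theorem const {g : E → F} (hs : UniqueDiffOn ℝ s) (hc : IsCompact s) (hg : ContDiffOn ℝ m g s) :
    UnifCk m (fun _ : ι => g) s := by
  have : ∀ j : ℕ, ∃ C : ℝ, j ≤ m → ∀ x ∈ s, ‖iteratedFDerivWithin ℝ j g s x‖ ≤ C := fun j => by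
    by_cases hj : j ≤ m
    · obtain ⟨C, hC⟩ := hc.exists_bound_of_continuousOn
        (hg.continuousOn_iteratedFDerivWithin (m := j) (by exact_mod_cast hj) hs)
      exact ⟨C, fun _ => hC⟩
    · exact ⟨0, fun h => absurd h hj⟩
  choose C hC using this
  refine ⟨fun _ => hg, ∑ j ∈ Finset.range (m + 1), |C j|, fun _ j hj x hx => ?_⟩
  refine (hC j hj x hx).trans ((le_abs_self _).trans ?_)
  exact Finset.single_le_sum (f := fun j => |C j|) (fun _ _ => abs_nonneg _)
    (Finset.mem_range.2 (by omega))

end UnifCk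

end UnifCk

/-! ### The radial retraction onto the unit ball -/

section Retraction

variable {X : Type} [NormedAddCommGroup X] [InnerProductSpace ℝ X]

/-- The radial retraction of an inner product space onto its closed unit ball, which is the
nearest-point projection. -/
def ballRetract (x : X) : X := (max 1 ‖x‖)⁻¹ • x

theorem ballRetract_of_mem {x : X} (hx : x ∈ Metric.closedBall (0 : X) 1) : ballRetract x = x := by
  have : ‖x‖ ≤ 1 := by simpa using hx
  simp [ballRetract, max_eq_left this]

theorem norm_ballRetract_of_one_le {x : X} (hx : 1 ≤ ‖x‖) : ‖ballRetract x‖ = 1 := by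
  rw [ballRetract, max_eq_right hx, norm_smul, norm_inv, norm_norm,
    inv_mul_cancel₀ (by positivity)]

theorem ballRetract_mem (x : X) : ballRetract x ∈ Metric.closedBall (0 : X) 1 := by
  rcases le_total ‖x‖ 1 with h | h
  · rw [ballRetract_of_mem (by simpa using h)]; simpa using h
  · simp [norm_ballRetract_of_one_le h]

/-- The variational inequality of the nearest-point projection. -/
theorem inner_sub_ballRetract_nonpos (x : X) {z : X} (hz : ‖z‖ ≤ 1) :
    inner ℝ (x - ballRetract x) (z - ballRetract x) ≤ 0 := by
  rcases le_total ‖x‖ 1 with h | h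
  · simp [ballRetract_of_mem (x := x) (by simpa using h)]
  · set p := ballRetract x with hp
    have hp1 : ‖p‖ = 1 := norm_ballRetract_of_one_le h
    have hxp : x = ‖x‖ • p := by
      rw [hp, ballRetract, max_eq_right h, smul_inv_smul₀ (by positivity)]
    have h1 : x - p = (‖x‖ - 1) • p := by rw [sub_smul, one_smul, ← hxp]
    rw [h1, real_inner_smul_left, inner_sub_right, real_inner_self_eq_norm_sq, hp1]
    have h2 : inner ℝ p z ≤ 1 := (real_inner_le_norm p z).trans (by rw [hp1]; linarith)
    nlinarith

theorem norm_ballRetract_sub_le (x y : X) : ‖ballRetract x - ballRetract y‖ ≤ ‖x - y‖ := by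
  set p := ballRetract x
  set q := ballRetract y
  have h1 := inner_sub_ballRetract_nonpos x (z := q) (by simpa using ballRetract_mem y)
  have h2 := inner_sub_ballRetract_nonpos y (z := p) (by simpa using ballRetract_mem x)
  change inner ℝ (x - p) (q - p) ≤ 0 at h1
  have h3 : ‖p - q‖ ^ 2 = inner ℝ (x - y) (p - q) + inner ℝ (x - p) (q - p)
      + inner ℝ (y - q) (p - q) := by
    rw [← real_inner_self_eq_norm_sq]
    simp only [inner_sub_left, inner_sub_right]
    ring
  have h4 := real_inner_le_norm (x - y) (p - q)
  by_contra! h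
  have := norm_nonneg (x - y)
  nlinarith

/-- A displacement of the ball that vanishes on the sphere and is `1/2`-Lipschitz reaches all points
of the ball: composed with the retraction, it is zero outside the ball and a contraction of the
whole space. -/
theorem exists_add_eq_of_lipschitz [CompleteSpace X] {ξ : X → X}
    (hL : ∀ y ∈ Metric.closedBall (0 : X) 1, ∀ y' ∈ Metric.closedBall (0 : X) 1,
      ‖ξ y - ξ y'‖ ≤ 1 / 2 * ‖y - y'‖)
    (h0 : ∀ y ∈ Metric.sphere (0 : X) 1, ξ y = 0) {x : X} (hx : x ∈ Metric.closedBall (0 : X) 1) :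
    ∃ y ∈ Metric.closedBall (0 : X) 1, y + ξ y = x := by
  have hc : ContractingWith (1 / 2) (fun y => x - ξ (ballRetract y)) := by
    refine ⟨by rw [← NNReal.coe_lt_coe]; norm_num, LipschitzWith.of_dist_le_mul fun y y' => ?_⟩
    rw [dist_eq_norm, dist_eq_norm, sub_sub_sub_cancel_left, norm_sub_rev]
    refine (hL _ (ballRetract_mem y) _ (ballRetract_mem y')).trans ?_
    have := norm_ballRetract_sub_le y y'
    simp only [NNReal.coe_div, NNReal.coe_one, NNReal.coe_ofNat]
    linarith
  obtain ⟨y, hy, -⟩ := hc.exists_fixedPoint 0 (edist_ne_top _ _)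
  have hy' : x - ξ (ballRetract y) = y := hy
  have hyB : y ∈ Metric.closedBall (0 : X) 1 := by
    by_contra h
    have h1 : 1 < ‖y‖ := by simpa using h
    rw [h0 _ (by simpa using norm_ballRetract_of_one_le h1.le), sub_zero] at hy'
    exact h (hy' ▸ hx)
  refine ⟨y, hyB, ?_⟩
  rw [ballRetract_of_mem hyB] at hy'
  exact (sub_eq_iff_eq_add.1 hy').symm

theorem exists_mem_sphere_norm_sub [Nontrivial X] {y : X} (hy : y ∈ Metric.closedBall (0 : X) 1) :
    ∃ b ∈ Metric.sphere (0 : X) 1, ‖y - b‖ = 1 - ‖y‖ := by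
  have hy1 : ‖y‖ ≤ 1 := by simpa using hy
  rcases eq_or_ne y 0 with rfl | h
  · obtain ⟨b, hb⟩ := exists_norm_eq X (zero_le_one' ℝ)
    exact ⟨b, by simpa using hb, by simp [hb]⟩
  · have hn : ‖y‖ ≠ 0 := norm_ne_zero_iff.2 h
    refine ⟨‖y‖⁻¹ • y, by simp [norm_smul, hn], ?_⟩
    have : y - ‖y‖⁻¹ • y = (‖y‖ - 1) • (‖y‖⁻¹ • y) := by
      rw [sub_smul, one_smul, smul_inv_smul₀ hn]
    rw [this, norm_smul, norm_smul, norm_inv, norm_norm, inv_mul_cancel₀ hn, Real.norm_eq_abs,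
      abs_of_nonpos (by linarith)]
    ring

end Retraction

/-! ### A fixed point problem with displacements in the ball -/

section FixedPoint

variable {X : Type} [NormedAddCommGroup X] [InnerProductSpace ℝ X]
  {κ : Type}

/-- The displacement `ξ_i` is changed so that `y + ξ_i` is retracted to the ball. -/
def displRetract (y : X) (Z : κ → X × ℝ) : κ → X × ℝ :=
  fun i => (ballRetract (y + (Z i).1) - y, (Z i).2)

theorem displRetract_eq {y : X} {Z : κ → X × ℝ}
    (h : ∀ i, y + (Z i).1 ∈ Metric.closedBall (0 : X) 1) : displRetract y Z = Z := by
  funext i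
  simp [displRetract, ballRetract_of_mem (h i)]

variable [Fintype κ]

/-- The set of all `(y, Z)` with `y` in the closed unit ball and `Z = (ξ_i, u_i)_i` of norm at most
`1` for which all the points `y + ξ_i` are in the closed unit ball. -/
def displDom (X κ : Type) [NormedAddCommGroup X] [InnerProductSpace ℝ X] [Fintype κ] :
    Set (X × (κ → X × ℝ)) :=
  {p | p.1 ∈ Metric.closedBall (0 : X) 1 ∧
    (∀ i, p.1 + (p.2 i).1 ∈ Metric.closedBall (0 : X) 1) ∧ p.2 ∈ Metric.closedBall 0 1}

theorem convex_displDom : Convex ℝ (displDom X κ) := by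
  have h1 : displDom X κ = (LinearMap.fst ℝ X (κ → X × ℝ) ⁻¹' Metric.closedBall 0 1) ∩
      ((⋂ i, (LinearMap.fst ℝ X (κ → X × ℝ) + LinearMap.fst ℝ X ℝ ∘ₗ LinearMap.proj i ∘ₗ
        LinearMap.snd ℝ X (κ → X × ℝ)) ⁻¹' Metric.closedBall 0 1) ∩
        LinearMap.snd ℝ X (κ → X × ℝ) ⁻¹' Metric.closedBall 0 1) := by
    ext p; simp [displDom]
  rw [h1]
  exact ((convex_closedBall _ _).linear_preimage _).inter
    ((convex_iInter fun i => (convex_closedBall _ _).linear_preimage _).inter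
      ((convex_closedBall _ _).linear_preimage _))

theorem uniqueDiffOn_displDom : UniqueDiffOn ℝ (displDom X κ) := by
  refine uniqueDiffOn_convex convex_displDom ⟨0, mem_interior.2
    ⟨Metric.ball 0 (1 / 2), fun p hp => ?_, Metric.isOpen_ball, by simp⟩⟩
  have hp : ‖p‖ < 1 / 2 := by simpa using hp
  have h1 : ‖p.1‖ ≤ ‖p‖ := norm_fst_le p
  have h2 : ‖p.2‖ ≤ ‖p‖ := norm_snd_le p
  refine ⟨by simp; linarith, fun i => ?_, by simp; linarith⟩
  have h3 : ‖(p.2 i).1‖ ≤ ‖p.2‖ := (norm_fst_le _).trans (norm_le_pi_norm p.2 i)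
  have := norm_add_le p.1 (p.2 i).1
  simp; linarith

theorem isCompact_displDom [FiniteDimensional ℝ X] : IsCompact (displDom X κ) := by
  have : ProperSpace X := FiniteDimensional.proper ℝ X
  refine ((isCompact_closedBall (0 : X) 1).prod
    (isCompact_closedBall (0 : κ → X × ℝ) 1)).of_isClosed_subset ?_ fun p hp => ⟨hp.1, hp.2.2⟩
  have h (i : κ) : Continuous fun p : X × (κ → X × ℝ) => p.1 + (p.2 i).1 := by fun_prop
  simp only [displDom, ← mem_preimage, ofPred_and, ofPred_forall]
  exact (Metric.isClosed_closedBall.preimage continuous_fst).inter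
    ((isClosed_iInter fun i => Metric.isClosed_closedBall.preimage (h i)).inter
      (Metric.isClosed_closedBall.preimage continuous_snd))

theorem norm_displRetract_sub_le (y y' : X) (Z Z' : κ → X × ℝ) :
    ‖displRetract y Z - displRetract y' Z'‖ ≤ 2 * ‖y - y'‖ + ‖Z - Z'‖ := by
  refine (pi_norm_le_iff_of_nonneg (by positivity)).2 fun i => ?_
  have h0 : ‖Z i - Z' i‖ ≤ ‖Z - Z'‖ := norm_le_pi_norm (Z - Z') i
  have h1 : ‖(Z i).1 - (Z' i).1‖ ≤ ‖Z - Z'‖ := (norm_fst_le (Z i - Z' i)).trans h0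
  have h2 : ‖(Z i).2 - (Z' i).2‖ ≤ ‖Z - Z'‖ := (norm_snd_le (Z i - Z' i)).trans h0
  refine max_le ?_ (h2.trans (by have := norm_nonneg (y - y'); linarith))
  change ‖ballRetract (y + (Z i).1) - y - (ballRetract (y' + (Z' i).1) - y')‖ ≤ _
  rw [sub_sub_sub_comm]
  have h3 := norm_ballRetract_sub_le (y + (Z i).1) (y' + (Z' i).1)
  rw [add_sub_add_comm] at h3
  have h4 := norm_sub_le (ballRetract (y + (Z i).1) - ballRetract (y' + (Z' i).1)) (y - y')
  have h5 := norm_add_le (y - y') ((Z i).1 - (Z' i).1)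
  linarith

theorem norm_displRetract_le {y : X} (hy : y ∈ Metric.closedBall (0 : X) 1) (Z : κ → X × ℝ) :
    ‖displRetract y Z‖ ≤ ‖Z‖ := by
  have h0 : displRetract y (0 : κ → X × ℝ) = 0 := displRetract_eq fun _ => by simpa using hy
  simpa [h0] using norm_displRetract_sub_le y y Z 0

theorem displRetract_mem {y : X} (hy : y ∈ Metric.closedBall (0 : X) 1) {Z : κ → X × ℝ}
    (hZ : ‖Z‖ ≤ 1) : (y, displRetract y Z) ∈ displDom X κ := by
  refine ⟨hy, fun i => ?_, by simpa using (norm_displRetract_le hy Z).trans hZ⟩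
  simpa [displRetract] using ballRetract_mem (y + (Z i).1)

/-- Fixed points `Z = K (y, Z)` that depend on the parameter `y` in a Lipschitz way. The retraction
makes the contraction principle applicable at each `y`; it does nothing at the solution, since
`ξ_i` is `1/2`-Lipschitz and zero on the sphere, so that `‖ξ_i‖ ≤ (1 - ‖y‖) / 2`. -/
theorem exists_fixedPoint_displ [CompleteSpace X] [Nontrivial X]
    {K : X × (κ → X × ℝ) → (κ → X × ℝ)} {δ : ℝ} (hδ0 : 0 < δ) (hδ1 : δ ≤ 1)
    (hK : DifferentiableOn ℝ K (displDom X κ))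
    (hK' : ∀ p ∈ displDom X κ, ‖p.2‖ ≤ δ → ‖fderivWithin ℝ K (displDom X κ) p‖ ≤ 1 / 8)
    (hK0 : ∀ y ∈ Metric.closedBall (0 : X) 1, ‖K (y, 0)‖ ≤ δ / 2)
    {b : X → κ → X × ℝ} (hb : ∀ y ∈ Metric.sphere (0 : X) 1,
      ‖b y‖ ≤ δ ∧ (∀ i, (b y i).1 = 0) ∧ K (y, b y) = b y) :
    ∃ Z : X → κ → X × ℝ,
      (∀ y ∈ Metric.closedBall (0 : X) 1, ‖Z y‖ ≤ δ ∧ (y, Z y) ∈ displDom X κ ∧ K (y, Z y) = Z y) ∧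
      (∀ y ∈ Metric.closedBall (0 : X) 1, ∀ y' ∈ Metric.closedBall (0 : X) 1,
        ‖Z y - Z y'‖ ≤ 1 / 2 * ‖y - y'‖) ∧
      ∀ y ∈ Metric.sphere (0 : X) 1, Z y = b y := by
  have hSB := Metric.sphere_subset_closedBall (x := (0 : X)) (ε := 1)
  -- `K` has the Lipschitz constant `1/8` where `‖Z‖ ≤ δ`.
  have hLip : ∀ p ∈ displDom X κ, ‖p.2‖ ≤ δ → ∀ q ∈ displDom X κ, ‖q.2‖ ≤ δ →
      ‖K p - K q‖ ≤ 1 / 8 * ‖p - q‖ := by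
    intro p hp hpδ q hq hqδ
    have hconv : Convex ℝ (displDom X κ ∩
        LinearMap.snd ℝ X (κ → X × ℝ) ⁻¹' Metric.closedBall 0 δ) :=
      convex_displDom.inter ((convex_closedBall _ _).linear_preimage _)
    exact hconv.norm_image_sub_le_of_norm_hasFDerivWithin_le
      (fun x hx => (hK x hx.1).hasFDerivWithinAt.mono inter_subset_left)
      (fun x hx => hK' x hx.1 (by simpa using hx.2)) ⟨hq, by simpa using hqδ⟩
      ⟨hp, by simpa using hpδ⟩
  have hmain : ∀ y ∈ Metric.closedBall (0 : X) 1, ∀ y' ∈ Metric.closedBall (0 : X) 1,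
      ∀ Z Z' : κ → X × ℝ, ‖Z‖ ≤ δ → ‖Z'‖ ≤ δ →
      ‖K (y, displRetract y Z) - K (y', displRetract y' Z')‖
        ≤ 1 / 4 * ‖y - y'‖ + 1 / 8 * ‖Z - Z'‖ := by
    intro y hy y' hy' Z Z' hZ hZ'
    have h1 := hLip _ (displRetract_mem hy (hZ.trans hδ1)) ((norm_displRetract_le hy Z).trans hZ)
      _ (displRetract_mem hy' (hZ'.trans hδ1)) ((norm_displRetract_le hy' Z').trans hZ')
    have h2 := norm_displRetract_sub_le y y' Z Z'
    have h3 : ‖(y, displRetract y Z) - (y', displRetract y' Z')‖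
        ≤ 2 * ‖y - y'‖ + ‖Z - Z'‖ := by
      refine max_le ?_ h2
      change ‖y - y'‖ ≤ _
      have := norm_nonneg (y - y')
      have := norm_nonneg (Z - Z')
      linarith
    linarith
  have hex : ∀ y ∈ Metric.closedBall (0 : X) 1,
      ∃ Z : κ → X × ℝ, ‖Z‖ ≤ δ ∧ K (y, displRetract y Z) = Z := by
    intro y hy
    have hmaps : MapsTo (fun Z => K (y, displRetract y Z)) (Metric.closedBall 0 δ)
        (Metric.closedBall 0 δ) := by
      intro Z hZ
      have hZ : ‖Z‖ ≤ δ := by simpa using hZ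
      have h0 : displRetract y (0 : κ → X × ℝ) = 0 := displRetract_eq fun _ => by simpa using hy
      have h1 := hmain y hy y hy Z 0 hZ (by simpa using hδ0.le)
      rw [h0, sub_self, norm_zero, sub_zero] at h1
      have h2 := norm_le_norm_add_norm_sub' (K (y, displRetract y Z)) (K (y, 0))
      have h3 := hK0 y hy
      simp only [mem_closedBall_zero_iff]
      linarith
    have hcontr : ContractingWith (1 / 8) (hmaps.restrict _ _ _) := by
      refine ⟨by rw [← NNReal.coe_lt_coe]; norm_num, LipschitzWith.of_dist_le_mul ?_⟩
      rintro ⟨Z, hZ⟩ ⟨Z', hZ'⟩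
      have := hmain y hy y hy Z Z' (by simpa using hZ) (by simpa using hZ')
      simpa [Subtype.dist_eq, dist_eq_norm] using this
    obtain ⟨Z, hZ, hfix, -⟩ := hcontr.exists_fixedPoint'
      Metric.isClosed_closedBall.isComplete hmaps (x := 0) (by simpa using hδ0.le)
      (edist_ne_top _ _)
    exact ⟨Z, by simpa using hZ, hfix⟩
  have : ∃ Z : X → κ → X × ℝ, ∀ y ∈ Metric.closedBall (0 : X) 1,
      ‖Z y‖ ≤ δ ∧ K (y, displRetract y (Z y)) = Z y := by
    choose! Z hZ using hex
    exact ⟨Z, hZ⟩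
  obtain ⟨Z, hZ⟩ := this
  have hZL : ∀ y ∈ Metric.closedBall (0 : X) 1, ∀ y' ∈ Metric.closedBall (0 : X) 1,
      ‖Z y - Z y'‖ ≤ 1 / 2 * ‖y - y'‖ := by
    intro y hy y' hy'
    have := hmain y hy y' hy' _ _ (hZ y hy).1 (hZ y' hy').1
    rw [(hZ y hy).2, (hZ y' hy').2] at this
    have := norm_nonneg (y - y')
    linarith
  have hZb : ∀ y ∈ Metric.sphere (0 : X) 1, Z y = b y := by
    intro y hy
    obtain ⟨h1, h2, h3⟩ := hb y hy
    have := hmain y (hSB hy) y (hSB hy) (Z y) (b y) (hZ y (hSB hy)).1 h1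
    rw [(hZ y (hSB hy)).2, displRetract_eq (Z := b y) (fun i => by simpa [h2 i] using hSB hy), h3,
      sub_self, norm_zero] at this
    have h0 : ‖Z y - b y‖ ≤ 0 := by linarith
    exact sub_eq_zero.1 (norm_le_zero_iff.1 h0)
  refine ⟨Z, fun y hy => ?_, hZL, hZb⟩
  have hdom : ∀ i, y + (Z y i).1 ∈ Metric.closedBall (0 : X) 1 := by
    intro i
    obtain ⟨c, hc, hyc⟩ := exists_mem_sphere_norm_sub hy
    have h1 := hZL y hy c (hSB hc)
    have h2 : ‖(Z y i).1 - (Z c i).1‖ ≤ ‖Z y - Z c‖ :=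
      (norm_fst_le (Z y i - Z c i)).trans (norm_le_pi_norm (Z y - Z c) i)
    rw [hZb c hc, (hb c hc).2.1 i, sub_zero, ← hZb c hc] at h2
    have h3 := norm_add_le y (Z y i).1
    have h4 : ‖y‖ ≤ 1 := by simpa using hy
    simp only [mem_closedBall_zero_iff]
    linarith
  have h1 := hZ y hy
  rw [displRetract_eq hdom] at h1
  exact ⟨h1.1, ⟨hy, hdom, by simpa using h1.1.trans hδ1⟩, h1.2⟩

end FixedPoint

/-! ### Regularity of fixed points -/

section Regularity

variable {ι : Type} {E F : Type} [NormedAddCommGroup E] [NormedSpace ℝ E]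
  [NormedAddCommGroup F] [NormedSpace ℝ F]

/-- The inverse of `1 - a`, for operators `a` of norm at most `1/2`, preserves uniform bounds. -/
theorem UnifCk.inverse_one_sub [FiniteDimensional ℝ F] {m : ℕ} {s : Set E} (hs : UniqueDiffOn ℝ s)
    {a : ι → E → F →L[ℝ] F} (ha : UnifCk m a s) (hb : ∀ i, ∀ x ∈ s, ‖a i x‖ ≤ 1 / 2) :
    UnifCk m (fun i x => Ring.inverse (1 - a i x)) s := by
  have : CompleteSpace F := FiniteDimensional.complete ℝ F
  have : ProperSpace (F →L[ℝ] F) := FiniteDimensional.proper ℝ _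
  have hu : UniqueDiffOn ℝ (Metric.closedBall (0 : F →L[ℝ] F) (1 / 2)) :=
    uniqueDiffOn_convex (convex_closedBall _ _)
      ⟨0, Metric.ball_subset_interior_closedBall (by simp)⟩
  have hg : ContDiffOn ℝ m (fun a : F →L[ℝ] F => Ring.inverse (1 - a))
      (Metric.closedBall 0 (1 / 2)) := by
    intro a ha
    have ha : ‖a‖ < 1 := by
      have : ‖a‖ ≤ 1 / 2 := by simpa using ha
      linarith
    have h1 := contDiffAt_ringInverse ℝ (n := m) (Units.oneSub a ha)
    rw [Units.val_oneSub] at h1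
    exact (h1.comp a (by fun_prop : ContDiffAt ℝ m (fun a : F →L[ℝ] F => 1 - a) a)).contDiffWithinAt
  exact (UnifCk.const hu (isCompact_closedBall _ _) hg).comp ha hu hs
    fun i x hx => by simpa using hb i x hx

/-- The derivative of a fixed point `Z = K (y, Z)`, by the chain rule solved for `DZ`. -/
theorem hasFDerivWithinAt_of_fixedPoint [CompleteSpace F] {s : Set E} {t : Set (E × F)}
    {K : E × F → F} {Z : E → F} {y : E} {L : E × F →L[ℝ] F} (hy : y ∈ s)
    (hst : ∀ y ∈ s, (y, Z y) ∈ t) (hZ : ∀ y ∈ s, K (y, Z y) = Z y)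
    (hLip : (fun y' => Z y' - Z y) =O[𝓝[s] y] fun y' => y' - y)
    (hK : HasFDerivWithinAt K L t (y, Z y)) (hL : ‖L ∘L .inr ℝ E F‖ ≤ 1 / 2) :
    HasFDerivWithinAt Z
      (Ring.inverse (1 - L ∘L .inr ℝ E F) ∘L (L ∘L .inl ℝ E F)) s y := by
  set a := L ∘L .inr ℝ E F
  have ha : ‖a‖ < 1 := by linarith
  set R := Ring.inverse (1 - a)
  have hR : ∀ v : F, R (v - a v) = v := by
    intro v
    have : R * (1 - a) = 1 :=
      Ring.inverse_mul_cancel _ (by rw [← Units.val_oneSub a ha]; exact Units.isUnit _)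
    simpa using congrArg (fun T : F →L[ℝ] F => T v) this
  have hcont : ContinuousWithinAt Z s y := by
    have h0 : Tendsto (fun y' => y' - y) (𝓝[s] y) (𝓝 0) := by
      have : Continuous fun y' : E => y' - y := by fun_prop
      simpa using (this.tendsto y).mono_left nhdsWithin_le_nhds
    have := hLip.trans_tendsto h0
    simpa [ContinuousWithinAt] using this.add_const (Z y)
  have hmap : Tendsto (fun y' => (y', Z y')) (𝓝[s] y) (𝓝[t] (y, Z y)) :=
    tendsto_nhdsWithin_iff.2 ⟨(continuousWithinAt_id.prodMk hcont).tendsto,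
      eventually_mem_nhdsWithin.mono hst⟩
  have h1 := hK.isLittleO.comp_tendsto hmap
  have h2 : (fun y' => ((y', Z y') - (y, Z y) : E × F)) =O[𝓝[s] y] fun y' => y' - y :=
    (isBigO_refl _ _).prod_left hLip
  have h3 := (R.isBigO_comp _ _).trans_isLittleO (h1.trans_isBigO h2)
  refine .of_isLittleO (h3.congr' ?_ .rfl)
  filter_upwards [eventually_mem_nhdsWithin] with y' hy'
  have h4 : L ((y', Z y') - (y, Z y)) = L (y' - y, 0) + a (Z y' - Z y) := by
    simp only [a, ContinuousLinearMap.comp_apply, ContinuousLinearMap.inr_apply, ← map_add]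
    simp
  simp only [Function.comp_apply, hZ y' hy', hZ y hy, h4]
  rw [show Z y' - Z y - (L (y' - y, 0) + a (Z y' - Z y)) =
    (Z y' - Z y - a (Z y' - Z y)) - L (y' - y, 0) by abel, map_sub, hR]
  rfl

/-- Fixed points of a uniformly `C^m` family of contractions are uniformly `C^m`: their
derivative `(1 - ∂_Z K)⁻¹ ∂_y K` is as smooth as the fixed points are known to be, up to
order `m - 1`. -/
theorem UnifCk.of_fixedPoint [FiniteDimensional ℝ F] {s : Set E} {t : Set (E × F)}
    (hs : UniqueDiffOn ℝ s) (ht : UniqueDiffOn ℝ t) {K : ι → E × F → F} {Z : ι → E → F} {C δ : ℝ}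
    (hst : ∀ i, ∀ y ∈ s, (y, Z i y) ∈ t) (hZ : ∀ i, ∀ y ∈ s, K i (y, Z i y) = Z i y)
    (hLip : ∀ i, ∀ y ∈ s, ∀ y' ∈ s, ‖Z i y - Z i y'‖ ≤ C * ‖y - y'‖)
    (hb : ∀ i, ∀ y ∈ s, ‖Z i y‖ ≤ δ)
    (hsc : IsCompact s)
    (hK' : ∀ i, ∀ y ∈ s, ‖fderivWithin ℝ (K i) t (y, Z i y)‖ ≤ 1 / 2) {m : ℕ}
    (hK : UnifCk (m + 1) K t) : UnifCk (m + 1) Z s := by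
  have : CompleteSpace F := FiniteDimensional.complete ℝ F
  have hinr : ∀ i, ∀ y ∈ s, ‖fderivWithin ℝ (K i) t (y, Z i y) ∘L .inr ℝ E F‖ ≤ 1 / 2 := by
    intro i y hy
    refine (ContinuousLinearMap.opNorm_le_bound _ (by norm_num) fun v => ?_)
    refine ((fderivWithin ℝ (K i) t (y, Z i y)).le_of_opNorm_le (hK' i y hy) _).trans ?_
    simp
  have hder : ∀ i, ∀ y ∈ s, HasFDerivWithinAt (Z i)
      (Ring.inverse (1 - fderivWithin ℝ (K i) t (y, Z i y) ∘L .inr ℝ E F) ∘L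
        (fderivWithin ℝ (K i) t (y, Z i y) ∘L .inl ℝ E F)) s y := by
    intro i y hy
    refine hasFDerivWithinAt_of_fixedPoint hy (hst i) (hZ i) ?_
      (((hK.1 i).differentiableOn (by simp)) _ (hst i y hy)).hasFDerivWithinAt (hinr i y hy)
    exact .of_bound C (eventually_mem_nhdsWithin.mono fun y' hy' => hLip i y' hy' y hy)
  have key : ∀ j ≤ m + 1, UnifCk j Z s := by
    intro j
    induction j with
    | zero =>
      exact fun _ => .zero_of (fun i y hy => (hder i y hy).continuousWithinAt) hb
    | succ j ih =>
      intro hj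
      have hid : UnifCk j (fun _ : ι => (id : E → E)) s := .const hs hsc contDiffOn_id
      have hDK : UnifCk j (fun i y => fderivWithin ℝ (K i) t (y, Z i y)) s :=
        ((hK.of_le hj).fderivWithin_of_succ ht).comp (hid.prodMk hs (ih (by omega))) ht hs hst
      have h2 : UnifCk j (fun i y => fderivWithin ℝ (K i) t (y, Z i y) ∘L .inr ℝ E F) s :=
        hDK.clm_comp ((ContinuousLinearMap.compL ℝ F (E × F) F).flip (.inr ℝ E F)) hs
      have h1 : UnifCk j (fun i y => fderivWithin ℝ (K i) t (y, Z i y) ∘L .inl ℝ E F) s :=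
        hDK.clm_comp ((ContinuousLinearMap.compL ℝ E (E × F) F).flip (.inl ℝ E F)) hs
      refine .succ_of hs (fun i y hy => (hder i y hy).differentiableWithinAt) hb
        (((h2.inverse_one_sub hs hinr).bilin (ContinuousLinearMap.compL ℝ E F F) hs h1).congr
          fun i y hy => (hder i y hy).fderivWithin (hs y hy))
  exact key _ le_rfl

end Regularity

/-! ### Small perturbations of a Newton map -/

section Perturbation

theorem norm_fderivWithin_add_smul_le {E F : Type} [NormedAddCommGroup E] [NormedSpace ℝ E]
    [NormedAddCommGroup F] [NormedSpace ℝ F] {f g : E → F} {s : Set E} {x : E} {r : ℝ}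
    (hs : UniqueDiffWithinAt ℝ s x) (hf : DifferentiableWithinAt ℝ f s x)
    (hg : DifferentiableWithinAt ℝ g s x) (hr : 0 ≤ r) :
    ‖fderivWithin ℝ (fun p => f p + r • g p) s x‖
      ≤ ‖fderivWithin ℝ f s x‖ + r * ‖fderivWithin ℝ g s x‖ := by
  have h : HasFDerivWithinAt (fun p => f p + r • g p)
      (fderivWithin ℝ f s x + r • fderivWithin ℝ g s x) s x :=
    hf.hasFDerivWithinAt.add (hg.hasFDerivWithinAt.const_smul r)
  rw [h.fderivWithin hs]
  refine (norm_add_le _ _).trans ?_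
  rw [norm_smul, Real.norm_of_nonneg hr]

variable {ι X κ : Type} [NormedAddCommGroup X] [InnerProductSpace ℝ X] [FiniteDimensional ℝ X]
  [Fintype κ]

/-- Small perturbations `K₀ + r E_i` of a map `K₀` that vanishes to first order at `Z = 0` have
fixed points, which depend on `y` in a uniformly `C^{m+1}` way. The functions `r b_i` are the
solutions on the sphere; their displacements have to be zero. -/
theorem exists_fixedPoint_perturbation [Nontrivial X] {m : ℕ}
    {K₀ : X × (κ → X × ℝ) → (κ → X × ℝ)} {E : ι → X × (κ → X × ℝ) → (κ → X × ℝ)}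
    {b : ι → X → κ → X × ℝ}
    (hK : ContDiffOn ℝ ∞ K₀ (displDom X κ))
    (hK0 : ∀ y ∈ Metric.closedBall (0 : X) 1, K₀ (y, 0) = 0)
    (hK1 : ∀ y ∈ Metric.closedBall (0 : X) 1,
      HasFDerivWithinAt K₀ (0 : X × (κ → X × ℝ) →L[ℝ] κ → X × ℝ) (displDom X κ) (y, 0))
    (hE : UnifCk (m + 1) E (displDom X κ))
    (hb : ∀ i, ∀ y ∈ Metric.sphere (0 : X) 1, ‖b i y‖ ≤ 1 ∧ (∀ j, (b i y j).1 = 0) ∧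
      ∀ r : ℝ, 0 < r → r ≤ 1 → K₀ (y, r • b i y) + r • E i (y, r • b i y) = r • b i y) :
    ∃ r : ℝ, 0 < r ∧ ∃ Z : ι → X → κ → X × ℝ,
      (∀ i, ∀ y ∈ Metric.closedBall (0 : X) 1,
        (y, Z i y) ∈ displDom X κ ∧ K₀ (y, Z i y) + r • E i (y, Z i y) = Z i y) ∧
      (∀ i j, ∀ x ∈ Metric.closedBall (0 : X) 1, ∃ y ∈ Metric.closedBall (0 : X) 1,
        y + (Z i y j).1 = x) ∧
      (∀ i, ∀ y ∈ Metric.sphere (0 : X) 1, Z i y = r • b i y) ∧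
      UnifCk (m + 1) Z (Metric.closedBall 0 1) := by
  have hcX : CompleteSpace X := FiniteDimensional.complete ℝ X
  have hpX : ProperSpace X := FiniteDimensional.proper ℝ X
  have hu := uniqueDiffOn_displDom (X := X) (κ := κ)
  have hball : UniqueDiffOn ℝ (Metric.closedBall (0 : X) 1) :=
    uniqueDiffOn_convex (convex_closedBall _ _)
      ⟨0, Metric.ball_subset_interior_closedBall (by simp)⟩
  have hmem0 : ∀ y ∈ Metric.closedBall (0 : X) 1, (y, (0 : κ → X × ℝ)) ∈ displDom X κ :=
    fun y hy => ⟨hy, fun i => by simpa using hy, by simp⟩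
  obtain ⟨C, hC1, hC⟩ := hE.exists_pos_bound
  -- The derivative of `K₀` is small near `Z = 0`, uniformly by compactness.
  have huc := isCompact_displDom.uniformContinuousOn_of_continuous
    (hK.continuousOn_fderivWithin hu (by simp))
  obtain ⟨δ₀, hδ₀, hδ⟩ := Metric.uniformContinuousOn_iff.1 huc (1 / 16) (by norm_num)
  obtain ⟨δ, hδ0, hδ1, hδδ⟩ : ∃ δ : ℝ, 0 < δ ∧ δ ≤ 1 ∧ δ < δ₀ :=
    ⟨min 1 (δ₀ / 2), by positivity, min_le_left _ _, (min_le_right _ _).trans_lt (by linarith)⟩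
  have hsmall : ∀ p ∈ displDom X κ, ‖p.2‖ ≤ δ →
      ‖fderivWithin ℝ K₀ (displDom X κ) p‖ ≤ 1 / 16 := by
    intro p hp hpδ
    have h1 := hδ p hp (p.1, 0) (hmem0 _ hp.1) (by
      rw [Prod.dist_eq]
      simpa [hδ₀] using hpδ.trans_lt hδδ)
    rw [(hK1 p.1 hp.1).fderivWithin (hu _ (hmem0 _ hp.1)), dist_zero_right] at h1
    exact h1.le
  -- Then `r C = δ / 16`, which makes `r E_i` and its first derivative small enough.
  set r := δ / (16 * C) with hr
  have hr0 : 0 < r := by positivity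
  have hrC : r * C = δ / 16 := by rw [hr]; field_simp
  have hrδ : r ≤ δ := by nlinarith
  have hKr : UnifCk (m + 1) (fun i p => K₀ p + r • E i p) (displDom X κ) :=
    (UnifCk.const hu isCompact_displDom (hK.of_le (by exact_mod_cast le_top))).add hu
      (hE.clm_comp (r • ContinuousLinearMap.id ℝ _) hu)
  have hKd : DifferentiableOn ℝ K₀ (displDom X κ) := hK.differentiableOn (by simp)
  have hEd : ∀ i, DifferentiableOn ℝ (E i) (displDom X κ) := fun i =>
    (hE.1 i).differentiableOn (by simp)
  have hbd : ∀ i, ∀ p ∈ displDom X κ, ‖p.2‖ ≤ δ →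
      ‖fderivWithin ℝ (fun p => K₀ p + r • E i p) (displDom X κ) p‖ ≤ 1 / 8 := by
    intro i p hp hpδ
    refine (norm_fderivWithin_add_smul_le (hu p hp) (hKd p hp) (hEd i p hp) hr0.le).trans ?_
    have h1 := hC i 1 (by omega) p hp
    rw [norm_iteratedFDerivWithin_one _ (hu p hp)] at h1
    have := hsmall p hp hpδ
    nlinarith
  have hsol := fun i => exists_fixedPoint_displ (K := fun p => K₀ p + r • E i p)
    (b := fun y => r • b i y) hδ0 hδ1 ((hKr.1 i).differentiableOn (by simp)) (hbd i)
    (fun y hy => by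
      have h1 := hC i 0 (by omega) _ (hmem0 y hy)
      rw [norm_iteratedFDerivWithin_zero] at h1
      rw [hK0 y hy, zero_add, norm_smul, Real.norm_of_nonneg hr0.le]
      nlinarith)
    (fun y hy => by
      obtain ⟨h1, h2, h3⟩ := hb i y hy
      refine ⟨?_, fun j => by simp [h2 j], h3 r hr0 (hrδ.trans hδ1)⟩
      rw [norm_smul, Real.norm_of_nonneg hr0.le]
      nlinarith)
  choose Z hZ hZL hZb using hsol
  refine ⟨r, hr0, Z, fun i y hy => (hZ i y hy).2, fun i j x hx => ?_, hZb,
    UnifCk.of_fixedPoint hball hu (fun i y hy => (hZ i y hy).2.1) (fun i y hy => (hZ i y hy).2.2)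
      hZL (fun i y hy => (hZ i y hy).1) (isCompact_closedBall _ _)
      (fun i y hy => (hbd i _ (hZ i y hy).2.1 (hZ i y hy).1).trans (by norm_num)) hKr⟩
  refine exists_add_eq_of_lipschitz (fun y hy y' hy' => ?_) (fun y hy => ?_) hx
  · exact ((norm_fst_le (Z i y j - Z i y' j)).trans (norm_le_pi_norm (Z i y - Z i y') j)).trans
      (hZL i y hy y' hy')
  · simp [hZb i y hy, (hb i y hy).2.1 j]

end Perturbation

theorem uniqueDiffOn_unitBall (n : ℕ) : UniqueDiffOn ℝ (unitBall n) :=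
  uniqueDiffOn_convex (convex_closedBall _ _)
    ⟨0, Metric.ball_subset_interior_closedBall (by simp)⟩

/-! ### The normals of the caps -/

variable {n : ℕ}

namespace DoubleBubble

variable (D : DoubleBubble n)

theorem ang_mem (i : Fin 3) : -Real.pi < D.ang i ∧ D.ang i < Real.pi := by
  have h1 := D.θ_pos 1
  have h2 := D.θ_pos 2
  have h3 := D.α_gt
  have h4 := D.α_lt
  fin_cases i <;> simp [ang] <;> constructor <;> linarith

/-- A cap lies on the zero set of a quadratic function whose gradient is a multiple of the normal;
this covers the flat balls as well. -/
theorem cap_equation {i : Fin 3} {x : Amb n} (hx : x ∈ D.Gam i) :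
    Real.sin (D.ang i) * inner ℝ (x - D.c) (x - D.c)
      - 2 * D.r * Real.cos (D.ang i) * inner ℝ D.a (x - D.c) = D.r ^ 2 * Real.sin (D.ang i) := by
  obtain ⟨h1, h2⟩ := D.ang_mem i
  rw [Gam, cap] at hx
  set β := D.ang i
  have ha : inner ℝ D.a D.a = 1 := by rw [real_inner_self_eq_norm_sq, D.norm_a]; norm_num
  split_ifs at hx with h0
  · simp [h0, hx.2]
  · have hs : Real.sin β ≠ 0 := fun h => h0 ((Real.sin_eq_zero_iff_of_lt_of_lt h1 h2).1 h)
    have h3 := congrArg (· ^ 2) hx.1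
    simp only [← sub_sub, div_pow, sq_abs] at h3
    generalize x - D.c = v at h3 ⊢
    rw [← real_inner_self_eq_norm_sq, inner_sub_left, inner_sub_right, inner_sub_right,
      real_inner_smul_right, real_inner_smul_left, real_inner_smul_left, real_inner_smul_right, ha,
      real_inner_comm D.a] at h3
    have hsc := Real.sin_sq_add_cos_sq β
    field_simp at h3
    apply mul_left_cancel₀ hs
    linear_combination h3 - D.r ^ 2 * hsc

theorem inner_normal_self {i : Fin 3} {x : Amb n} (hx : x ∈ D.Gam i) :
    inner ℝ (D.normal i x) (D.normal i x) = 1 := by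
  have h := D.cap_equation hx
  have ha : inner ℝ D.a D.a = 1 := by rw [real_inner_self_eq_norm_sq, D.norm_a]; norm_num
  have ho : D.o * D.o = 1 := by rcases D.o_sign with h | h <;> simp [h]
  have hr := D.r_pos.ne'
  have hsc := Real.sin_sq_add_cos_sq (D.ang i)
  rw [normal]
  generalize x - D.c = v at h ⊢
  simp only [real_inner_smul_left, real_inner_smul_right, inner_sub_left, inner_sub_right, ha,
    real_inner_comm D.a v]
  suffices h1 : (Real.sin (D.ang i) / D.r) ^ 2 * inner ℝ v v
      - 2 * (Real.sin (D.ang i) / D.r) * Real.cos (D.ang i) * inner ℝ D.a v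
      + Real.cos (D.ang i) ^ 2 = 1 by
    linear_combination D.o * D.o * h1 + ho
  field_simp
  linear_combination Real.sin (D.ang i) * h + D.r ^ 2 * hsc

theorem contDiff_normal (i : Fin 3) : ContDiff ℝ ∞ (D.normal i) := by
  unfold normal
  fun_prop

end DoubleBubble

namespace Frame

variable {D : DoubleBubble n} (P : Frame D)

theorem mem_Gam (i : Fin 3) {y : Par n} (hy : y ∈ unitBall n) : P.φ i y ∈ D.Gam i :=
  (P.φ_bij i).mapsTo hy

theorem hasFDerivWithinAt_φ (i : Fin 3) {y : Par n} (hy : y ∈ unitBall n) :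
    HasFDerivWithinAt (P.φ i) (fderivWithin ℝ (P.φ i) (unitBall n) y) (unitBall n) y :=
  ((P.φ_smooth i).differentiableOn (by simp) y hy).hasFDerivWithinAt

theorem contDiffOn_normal_φ (i : Fin 3) :
    ContDiffOn ℝ ∞ (fun y => D.normal i (P.φ i y)) (unitBall n) :=
  (D.contDiff_normal i).comp_contDiffOn (P.φ_smooth i)

theorem inner_normal_fderivWithin (i : Fin 3) {y : Par n} (hy : y ∈ unitBall n) (v : Par n) :
    inner ℝ (D.normal i (P.φ i y)) (fderivWithin ℝ (P.φ i) (unitBall n) y v) = 0 := by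
  set L := fderivWithin ℝ (P.φ i) (unitBall n) y
  have h1 : HasFDerivWithinAt (fun y => P.φ i y - D.c) L (unitBall n) y :=
    (P.hasFDerivWithinAt_φ i hy).sub_const _
  have h2 := ((h1.inner ℝ h1).const_mul (Real.sin (D.ang i))).sub
    ((((hasFDerivWithinAt_const D.a y (unitBall n)).inner ℝ h1).const_mul
      (2 * D.r * Real.cos (D.ang i))))
  have h3 : HasFDerivWithinAt (fun _ : Par n => D.r ^ 2 * Real.sin (D.ang i)) (0 : Par n →L[ℝ] ℝ)
    (unitBall n) y := hasFDerivWithinAt_const _ _ _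
  have h4 := (uniqueDiffOn_unitBall n y hy).eq h2
    (h3.congr (fun y hy => D.cap_equation (P.mem_Gam i hy)) (D.cap_equation (P.mem_Gam i hy)))
  have h5 := congrArg (fun T : Par n →L[ℝ] ℝ => T v) h4
  simp [fderivInnerCLM_apply] at h5
  have hr := D.r_pos.ne'
  rw [DoubleBubble.normal, real_inner_smul_left, inner_sub_left, real_inner_smul_left,
    real_inner_smul_left]
  rw [real_inner_comm (P.φ i y - D.c) (L v)] at h5
  field_simp
  linear_combination D.o * h5 / 2

/-! ### The linearized equation -/

/-- The linearization at `y` of the equation for the new parametrization: the displacements `ξ_i` of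
the parameters and the normal components `u_i` produce the vectors
`Dφ_i ξ_i - u_i N_i - (𝒯 u)_i τ_i`. -/
def lin (y : Par n) : (Fin 3 → Par n × ℝ) →L[ℝ] (Fin 3 → Amb n) :=
  ContinuousLinearMap.pi fun i =>
    fderivWithin ℝ (P.φ i) (unitBall n) y ∘L
        (ContinuousLinearMap.fst ℝ (Par n) ℝ ∘L ContinuousLinearMap.proj i)
      - (ContinuousLinearMap.snd ℝ (Par n) ℝ ∘L ContinuousLinearMap.proj i).smulRight
          (D.normal i (P.φ i y))
      - (∑ j, D.T i j • (ContinuousLinearMap.snd ℝ (Par n) ℝ ∘L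
          ContinuousLinearMap.proj j)).smulRight (P.τ i (P.φ i y))

theorem lin_apply (y : Par n) (Z : Fin 3 → Par n × ℝ) (i : Fin 3) :
    P.lin y Z i = fderivWithin ℝ (P.φ i) (unitBall n) y (Z i).1
      - (Z i).2 • D.normal i (P.φ i y)
      - (D.T.mulVec (fun j => (Z j).2) i) • P.τ i (P.φ i y) := by
  simp [lin, Matrix.mulVec, dotProduct]

theorem contDiffOn_lin : ContDiffOn ℝ ∞ P.lin (unitBall n) := by
  have h1 (i : Fin 3) : ContDiffOn ℝ ∞ (fderivWithin ℝ (P.φ i) (unitBall n)) (unitBall n) :=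
    (P.φ_smooth i).fderivWithin (uniqueDiffOn_unitBall n) (by simp)
  have h2 (Z : Fin 3 → Par n × ℝ) (i : Fin 3) :
      ContDiffOn ℝ ∞ (fun y => P.lin y Z i) (unitBall n) := by
    simp only [lin_apply]
    exact (((h1 i).clm_apply contDiffOn_const).sub
      ((P.contDiffOn_normal_φ i).const_smul _)).sub ((P.τ_smooth i).const_smul _)
  exact contDiffOn_clm_apply.2 fun Z => contDiffOn_pi.2 (h2 Z)

/-- The linearization is invertible: its normal components are the `-u_i`, because the `τ_i` are
tangential, and the `φ_i` are immersions. -/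
theorem lin_isInvertible {y : Par n} (hy : y ∈ unitBall n) : (P.lin y).IsInvertible := by
  have hinj : Function.Injective (P.lin y) := by
    rw [injective_iff_map_eq_zero]
    intro Z hZ
    have hu : ∀ i, (Z i).2 = 0 := by
      intro i
      have h1 := congrArg (fun v => inner ℝ (D.normal i (P.φ i y)) v) (congrFun hZ i)
      have h2 := P.τ_tangent i _ (P.mem_Gam i hy)
      rw [real_inner_comm] at h2
      have h3 := D.inner_normal_self (P.mem_Gam i hy)
      rw [lin_apply, inner_sub_right, inner_sub_right, real_inner_smul_right,
        real_inner_smul_right, h2, h3, P.inner_normal_fderivWithin i hy] at h1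
      simpa using h1
    funext i
    refine Prod.ext (P.φ_immersion i y hy ?_) (hu i)
    have := congrFun hZ i
    rw [lin_apply, show (fun j => (Z j).2) = 0 from funext hu] at this
    simpa [hu i] using this
  have hrank : Module.finrank ℝ (Fin 3 → Par n × ℝ) = Module.finrank ℝ (Fin 3 → Amb n) := by
    rw [Module.finrank_pi_fintype, Module.finrank_pi_fintype]
    simp [Module.finrank_prod]
  exact ⟨(LinearEquiv.ofInjectiveOfFinrankEq (P.lin y).toLinearMap hinj
    hrank).toContinuousLinearEquiv, by ext; rfl⟩

theorem contDiffOn_lin_inverse :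
    ContDiffOn ℝ ∞ (fun y => (P.lin y).inverse) (unitBall n) := fun y hy =>
  ((P.lin_isInvertible hy).contDiffAt_map_inverse).comp_contDiffWithinAt y (P.contDiffOn_lin y hy)

/-- The unperturbed equation: `Z = (ξ_i, u_i)_i` solves it when `φ_i (y + ξ_i)` is the point
`φ_i + u_i N_i + (𝒯 u)_i τ_i` at `y`. -/
def resid (p : Par n × (Fin 3 → Par n × ℝ)) (i : Fin 3) : Amb n :=
  P.φ i (p.1 + (p.2 i).1) - (P.φ i p.1 + (p.2 i).2 • D.normal i (P.φ i p.1)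
    + (D.T.mulVec (fun j => (p.2 j).2) i) • P.τ i (P.φ i p.1))

/-- The Newton map of the unperturbed equation. -/
def newton (p : Par n × (Fin 3 → Par n × ℝ)) : Fin 3 → Par n × ℝ :=
  p.2 - (P.lin p.1).inverse (P.resid p)

theorem mapsTo_displ (i : Fin 3) : MapsTo (fun p : Par n × (Fin 3 → Par n × ℝ) => p.1 + (p.2 i).1)
    (displDom (Par n) (Fin 3)) (unitBall n) := fun _ hp => hp.2.1 i

theorem mapsTo_fst_displDom : MapsTo (fun p : Par n × (Fin 3 → Par n × ℝ) => p.1)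
    (displDom (Par n) (Fin 3)) (unitBall n) := fun _ hp => hp.1

theorem contDiffOn_resid : ContDiffOn ℝ ∞ P.resid (displDom (Par n) (Fin 3)) := by
  rw [contDiffOn_pi]
  intro i
  have hs (j : Fin 3) : ContDiff ℝ ∞ (fun p : Par n × (Fin 3 → Par n × ℝ) => (p.2 j).2) := by
    fun_prop
  have h1 := (P.φ_smooth i).comp (by fun_prop : ContDiff ℝ ∞
    (fun p : Par n × (Fin 3 → Par n × ℝ) => p.1 + (p.2 i).1)).contDiffOn (mapsTo_displ i)
  have h2 := (P.φ_smooth i).comp contDiff_fst.contDiffOn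
    (mapsTo_fst_displDom (n := n))
  have h3 := (P.contDiffOn_normal_φ i).comp contDiff_fst.contDiffOn
    (mapsTo_fst_displDom (n := n))
  have h4 := (P.τ_smooth i).comp contDiff_fst.contDiffOn
    (mapsTo_fst_displDom (n := n))
  have h5 : ContDiff ℝ ∞ (fun p : Par n × (Fin 3 → Par n × ℝ) =>
      D.T.mulVec (fun j => (p.2 j).2) i) := by
    simp only [Matrix.mulVec, dotProduct]
    exact ContDiff.sum fun j _ => contDiff_const.mul (hs j)
  exact h1.sub ((h2.add ((hs i).contDiffOn.smul h3)).add (h5.contDiffOn.smul h4))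

theorem contDiffOn_newton : ContDiffOn ℝ ∞ P.newton (displDom (Par n) (Fin 3)) :=
  contDiff_snd.contDiffOn.sub ((P.contDiffOn_lin_inverse.comp contDiff_fst.contDiffOn
    mapsTo_fst_displDom).clm_apply P.contDiffOn_resid)

theorem resid_zero (y : Par n) : P.resid (y, 0) = 0 := by
  funext i
  have : D.T.mulVec (fun _ => (0 : ℝ)) i = 0 := by simp [Matrix.mulVec, dotProduct]
  simp [resid, this]

theorem hasFDerivWithinAt_resid_apply {y : Par n} (hy : y ∈ unitBall n) (i : Fin 3) :
    HasFDerivWithinAt (fun p => P.resid p i)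
      (ContinuousLinearMap.proj i ∘L P.lin y ∘L
        ContinuousLinearMap.snd ℝ (Par n) (Fin 3 → Par n × ℝ))
      (displDom (Par n) (Fin 3)) (y, 0) := by
  let ev (j : Fin 3) : Par n × (Fin 3 → Par n × ℝ) →L[ℝ] Par n × ℝ :=
    ContinuousLinearMap.proj j ∘L ContinuousLinearMap.snd ℝ (Par n) (Fin 3 → Par n × ℝ)
  let pr1 : Par n × (Fin 3 → Par n × ℝ) →L[ℝ] Par n :=
    ContinuousLinearMap.fst ℝ (Par n) (Fin 3 → Par n × ℝ)
  let u (j : Fin 3) : Par n × (Fin 3 → Par n × ℝ) →L[ℝ] ℝ :=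
    ContinuousLinearMap.snd ℝ (Par n) ℝ ∘L ev j
  let Tu : Par n × (Fin 3 → Par n × ℝ) →L[ℝ] ℝ := ∑ j, D.T i j • u j
  let ξ : Par n × (Fin 3 → Par n × ℝ) →L[ℝ] Par n :=
    pr1 + ContinuousLinearMap.fst ℝ (Par n) ℝ ∘L ev i
  have hξ0 : ξ (y, 0) = y := by simp [ξ, pr1, ev]
  have hu0 (j : Fin 3) : u j (y, 0) = 0 := by simp [u, ev]
  have hTu0 : Tu (y, 0) = 0 := by simp [Tu, hu0]
  have hTu (p) : Tu p = D.T.mulVec (fun j => (p.2 j).2) i := by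
    simp [Tu, u, ev, Matrix.mulVec, dotProduct]
  have h1 : HasFDerivWithinAt (fun p => P.φ i (ξ p))
      (fderivWithin ℝ (P.φ i) (unitBall n) y ∘L ξ) (displDom (Par n) (Fin 3)) (y, 0) :=
    HasFDerivWithinAt.comp (t := unitBall n) (y, 0)
      (by rw [hξ0]; exact P.hasFDerivWithinAt_φ i hy)
      ξ.hasFDerivWithinAt (mapsTo_displ i)
  have h2 : HasFDerivWithinAt (fun p => P.φ i (pr1 p))
      (fderivWithin ℝ (P.φ i) (unitBall n) y ∘L pr1) (displDom (Par n) (Fin 3)) (y, 0) :=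
    HasFDerivWithinAt.comp (t := unitBall n) (y, 0) (P.hasFDerivWithinAt_φ i hy)
      pr1.hasFDerivWithinAt mapsTo_fst_displDom
  -- A product whose scalar factor vanishes at `(y, 0)`.
  have h3 (c : Par n × (Fin 3 → Par n × ℝ) →L[ℝ] ℝ) (hc : c (y, 0) = 0) {v : Par n → Amb n}
      (hv : ContDiffOn ℝ ∞ v (unitBall n)) : HasFDerivWithinAt (fun p => c p • v (pr1 p))
      (c.smulRight (v y)) (displDom (Par n) (Fin 3)) (y, 0) := by
    have h4 : HasFDerivWithinAt (fun p => v (pr1 p)) (fderivWithin ℝ v (unitBall n) y ∘L pr1)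
        (displDom (Par n) (Fin 3)) (y, 0) :=
      HasFDerivWithinAt.comp (t := unitBall n) (y, 0)
        (hv.differentiableOn (by simp) y hy).hasFDerivWithinAt
        pr1.hasFDerivWithinAt mapsTo_fst_displDom
    have h5 := c.hasFDerivWithinAt (s := displDom (Par n) (Fin 3)) (x := (y, 0))
    have h6 := h5.fun_smul h4
    rw [hc, zero_smul, zero_add] at h6
    exact h6
  have h7 := h1.fun_sub ((h2.fun_add (h3 (u i) (hu0 i) (P.contDiffOn_normal_φ i))).fun_add
    (h3 Tu hTu0 (P.τ_smooth i)))
  refine (h7.congr_fderiv ?_).congr (fun p _ => ?_) ?_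
  · refine ContinuousLinearMap.ext fun p => ?_
    change fderivWithin ℝ (P.φ i) (unitBall n) y (p.1 + (p.2 i).1)
      - (fderivWithin ℝ (P.φ i) (unitBall n) y p.1 + (p.2 i).2 • D.normal i (P.φ i y)
        + Tu p • P.τ i (P.φ i y)) = P.lin y p.2 i
    rw [lin_apply, hTu, map_add]
    abel
  · simp only [hTu]; rfl
  · simp only [hTu]; rfl

theorem hasFDerivWithinAt_resid {y : Par n} (hy : y ∈ unitBall n) :
    HasFDerivWithinAt P.resid (P.lin y ∘L ContinuousLinearMap.snd ℝ (Par n) (Fin 3 → Par n × ℝ))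
      (displDom (Par n) (Fin 3)) (y, 0) :=
  hasFDerivWithinAt_pi'.2 (P.hasFDerivWithinAt_resid_apply hy)

/-- As for every Newton map, the derivative vanishes at the solutions `(y, 0)`. -/
theorem hasFDerivWithinAt_newton {y : Par n} (hy : y ∈ unitBall n) :
    HasFDerivWithinAt P.newton
      (0 : Par n × (Fin 3 → Par n × ℝ) →L[ℝ] Fin 3 → Par n × ℝ)
      (displDom (Par n) (Fin 3)) (y, 0) := by
  have h1 : HasFDerivWithinAt (fun p : Par n × (Fin 3 → Par n × ℝ) => (P.lin p.1).inverse) _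
      (displDom (Par n) (Fin 3)) (y, 0) :=
    HasFDerivWithinAt.comp (g := fun y => (P.lin y).inverse) (t := unitBall n) (y, 0)
      (P.contDiffOn_lin_inverse.differentiableOn (by simp) y hy).hasFDerivWithinAt
      hasFDerivWithinAt_fst mapsTo_fst_displDom
  have h2 := (hasFDerivWithinAt_snd (𝕜 := ℝ) (p := ((y, 0) : Par n × (Fin 3 → Par n × ℝ)))
    (s := displDom (Par n) (Fin 3))).fun_sub (h1.clm_apply (P.hasFDerivWithinAt_resid hy))
  refine h2.congr_fderiv ?_
  refine ContinuousLinearMap.ext fun p => ?_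
  rw [P.resid_zero y]
  simp [(P.lin_isInvertible hy).inverse_apply_self]

theorem newton_zero (y : Par n) : P.newton (y, 0) = 0 := by
  simp [newton, P.resid_zero y]

end Frame

/-! ### The projection to the triple junction -/

namespace DoubleBubble

variable (D : DoubleBubble n)

/-- The component of `x - c` in the hyperplane of `Σ_*`. -/
def planar (x : Amb n) : Amb n := (x - D.c) - inner ℝ D.a (x - D.c) • D.a

/-- The nearest point of `Σ_*` to a point off the axis `c + ℝ a`. -/
def foot (x : Amb n) : Amb n := D.c + (D.r / ‖D.planar x‖) • D.planar x

theorem inner_a_planar (x : Amb n) : inner ℝ D.a (D.planar x) = 0 := by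
  rw [planar, inner_sub_right, real_inner_smul_right, real_inner_self_eq_norm_sq, D.norm_a]
  ring

theorem inner_planar {q : Amb n} (hq : q ∈ D.Sig) (x : Amb n) :
    inner ℝ (x - D.c) (q - D.c) = inner ℝ (D.planar x) (q - D.c) := by
  rw [planar, inner_sub_left (x - D.c), real_inner_smul_left, hq.2]
  ring

theorem foot_mem {x : Amb n} (hx : D.planar x ≠ 0) : D.foot x ∈ D.Sig := by
  have h : ‖D.planar x‖ ≠ 0 := norm_ne_zero_iff.2 hx
  constructor
  · rw [foot, add_sub_cancel_left, norm_smul, norm_div, norm_norm, div_mul_cancel₀ _ h,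
      Real.norm_of_nonneg D.r_pos.le]
  · rw [foot, add_sub_cancel_left, real_inner_smul_right, D.inner_a_planar, mul_zero]

theorem dist_sq_of_mem_Sig {q : Amb n} (hq : q ∈ D.Sig) (x : Amb n) :
    dist x q ^ 2 = ‖x - D.c‖ ^ 2 - 2 * inner ℝ (D.planar x) (q - D.c) + D.r ^ 2 := by
  rw [dist_eq_norm, ← sub_sub_sub_cancel_right x q D.c, norm_sub_sq_real, D.inner_planar hq, hq.1]

theorem isNearest_foot {x : Amb n} (hx : D.planar x ≠ 0) : D.IsNearest x (D.foot x) := by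
  have h : ‖D.planar x‖ ≠ 0 := norm_ne_zero_iff.2 hx
  refine ⟨D.foot_mem hx, fun q hq => ?_⟩
  rw [← sq_le_sq₀ dist_nonneg dist_nonneg, D.dist_sq_of_mem_Sig hq,
    D.dist_sq_of_mem_Sig (D.foot_mem hx)]
  have h1 : inner ℝ (D.planar x) (D.foot x - D.c) = D.r * ‖D.planar x‖ := by
    rw [foot, add_sub_cancel_left, real_inner_smul_right, real_inner_self_eq_norm_sq]
    field_simp
  have h2 := real_inner_le_norm (D.planar x) (q - D.c)
  rw [hq.1] at h2
  linarith

/-- Points of the axis have no unique nearest point: the antipode of a nearest point is another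
one. -/
theorem planar_ne_zero {x : Amb n} (hx : ∃! p, D.IsNearest x p) : D.planar x ≠ 0 := by
  intro h
  obtain ⟨p, hp, huniq⟩ := hx
  have hanti : D.c - (p - D.c) ∈ D.Sig := by
    constructor
    · rw [sub_sub_cancel_left, norm_neg, hp.1.1]
    · rw [sub_sub_cancel_left, inner_neg_right, hp.1.2, neg_zero]
  have hdist : ∀ q ∈ D.Sig, ∀ q' ∈ D.Sig, dist x q ≤ dist x q' := by
    intro q hq q' hq'
    rw [← sq_le_sq₀ dist_nonneg dist_nonneg, D.dist_sq_of_mem_Sig hq, D.dist_sq_of_mem_Sig hq', h]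
    simp
  have h1 := huniq _ ⟨hanti, hdist _ hanti⟩
  have h2 : (2 : ℝ) • (p - D.c) = 0 := by
    rw [two_smul, show p - D.c + (p - D.c) = p - (D.c - (p - D.c)) by abel, h1, sub_self]
  have h3 : p - D.c = 0 := by simpa using h2
  have h4 := hp.1.1
  rw [h3, norm_zero] at h4
  exact D.r_pos.ne h4

theorem pr_eq_foot {x : Amb n} (hx : ∃! p, D.IsNearest x p) : D.pr x = D.foot x :=
  hx.unique (Classical.epsilon_spec hx.exists) (D.isNearest_foot (D.planar_ne_zero hx))

theorem pr_of_mem_Sig {x : Amb n} (hx : x ∈ D.Sig) : D.pr x = x := by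
  have h : D.IsNearest x (D.pr x) :=
    Classical.epsilon_spec (p := D.IsNearest x) ⟨x, hx, fun q _ => by simp⟩
  have := h.2 x hx
  rw [dist_self] at this
  exact (dist_le_zero.1 this).symm

theorem contDiff_planar : ContDiff ℝ ∞ D.planar := by
  have h : ContDiff ℝ ∞ fun x => x - D.c := contDiff_id.sub contDiff_const
  exact h.sub ((contDiff_const.inner ℝ h).smul contDiff_const)

theorem contDiffAt_foot {x : Amb n} (hx : D.planar x ≠ 0) : ContDiffAt ℝ ∞ D.foot x := by
  have h := D.contDiff_planar.contDiffAt (x := x)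
  exact contDiffAt_const.add ((contDiffAt_const.div (h.norm ℝ hx) (norm_ne_zero_iff.2 hx)).smul h)

end DoubleBubble

/-! ### Lifting smooth maps through an embedding of a compact set -/

section Lift

theorem continuousOn_lift {E X A : Type} [TopologicalSpace E] [TopologicalSpace X]
    [TopologicalSpace A] [T2Space A] {B : Set X} {s : Set E} {φ : X → A} {q : E → X} {p : E → A}
    (hB : IsCompact B) (hφ : ContinuousOn φ B) (hinj : InjOn φ B)
    (hq : MapsTo q s B) (hp : ContinuousOn p s) (hqp : ∀ x ∈ s, φ (q x) = p x) :
    ContinuousOn q s := by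
  have : CompactSpace B := isCompact_iff_compactSpace.1 hB
  have hemb := (continuousOn_iff_continuous_domRestrict.1 hφ).isClosedEmbedding
    (injOn_iff_injective.1 hinj)
  have h1 : Continuous (hq.restrict q s B) := by
    rw [hemb.isInducing.continuous_iff]
    refine (continuousOn_iff_continuous_domRestrict.1 hp).congr fun x => ?_
    simp [hqp x.1 x.2]
  exact continuousOn_iff_continuous_domRestrict.2 (continuous_subtype_val.comp h1)

variable {E X A : Type} [NormedAddCommGroup E] [NormedSpace ℝ E] [NormedAddCommGroup X]
  [NormedSpace ℝ X] [NormedAddCommGroup A] [NormedSpace ℝ A]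
  {B : Set X} {s : Set E} {φ : X → A} {L : X → A →L[ℝ] X} {q : E → X} {p : E → A}

theorem hasFDerivWithinAt_lift {x : E} (hx : x ∈ s) {φ' : X →L[ℝ] A} {L₀ : A →L[ℝ] X}
    {p' : E →L[ℝ] A} (hφ : HasFDerivWithinAt φ φ' B (q x)) (hL : ∀ v, L₀ (φ' v) = v)
    (hq : MapsTo q s B) (hqc : ContinuousWithinAt q s x) (hp : HasFDerivWithinAt p p' s x)
    (hqp : ∀ x ∈ s, φ (q x) = p x) : HasFDerivWithinAt q (L₀ ∘L p') s x := by
  have hmap : Tendsto q (𝓝[s] x) (𝓝[B] (q x)) :=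
    tendsto_nhdsWithin_iff.2 ⟨hqc, eventually_mem_nhdsWithin.mono hq⟩
  have h1 := (L₀.isBigO_comp _ _).trans_isLittleO (hφ.isLittleO.comp_tendsto hmap)
  have h2 : (fun x' => L₀ (p x' - p x) - (q x' - q x)) =o[𝓝[s] x] fun x' => q x' - q x := by
    refine h1.congr' ?_ .rfl
    filter_upwards [eventually_mem_nhdsWithin] with x' hx'
    simp only [Function.comp_apply]
    rw [map_sub, hL, hqp x' hx', hqp x hx]
  have h3 : (fun x' => q x' - q x) =O[𝓝[s] x] fun x' => x' - x :=
    (h2.right_isBigO_add.congr_right fun x' => by abel).trans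
      ((L₀.isBigO_comp _ _).trans hp.isBigO_sub)
  have h4 := (L₀.isBigO_comp _ _).trans_isLittleO hp.isLittleO
  refine .of_isLittleO ((h4.sub (h2.trans_isBigO h3)).congr_left fun x' => ?_)
  simp only [map_sub, ContinuousLinearMap.comp_apply]
  abel

theorem contDiffOn_lift (hs : UniqueDiffOn ℝ s) (hB : IsCompact B) (hφ : ContDiffOn ℝ ∞ φ B)
    (hinj : InjOn φ B) (hL : ContDiffOn ℝ ∞ L B)
    (hLφ : ∀ y ∈ B, ∀ v, L y (fderivWithin ℝ φ B y v) = v) (hq : MapsTo q s B)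
    (hp : ContDiffOn ℝ ∞ p s) (hqp : ∀ x ∈ s, φ (q x) = p x) : ContDiffOn ℝ ∞ q s := by
  have hqc := continuousOn_lift hB hφ.continuousOn hinj hq hp.continuousOn hqp
  have hder : ∀ x ∈ s, HasFDerivWithinAt q (L (q x) ∘L fderivWithin ℝ p s x) s x := fun x hx =>
    hasFDerivWithinAt_lift hx (hφ.differentiableOn (by simp) _ (hq hx)).hasFDerivWithinAt
      (hLφ _ (hq hx)) hq (hqc x hx) (hp.differentiableOn (by simp) x hx).hasFDerivWithinAt hqp
  refine contDiffOn_infty.2 fun m => ?_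
  induction m with
  | zero => exact contDiffOn_zero.2 hqc
  | succ m ih =>
    have h1 : ContDiffOn ℝ m (fun x => L (q x) ∘L fderivWithin ℝ p s x) s :=
      ((hL.of_le (by exact_mod_cast le_top)).comp ih hq).clm_comp
        ((hp.fderivWithin hs (m := ∞) (by simp)).of_le (by exact_mod_cast le_top))
    have h2 := (contDiffOn_succ_iff_fderivWithin (n := (m : ℕ∞ω)) hs).2
      ⟨fun x hx => (hder x hx).differentiableWithinAt, by simp,
        h1.congr fun x hx => (hder x hx).fderivWithin (hs x hx)⟩
    exact_mod_cast h2

end Lift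

namespace Frame

variable {D : DoubleBubble n} (P : Frame D)

theorem exists_leftInverse_fderivWithin : ∃ L : Par n → Amb n →L[ℝ] Par n,
    ContDiffOn ℝ ∞ L (unitBall n) ∧
      ∀ y ∈ unitBall n, ∀ v, L y (fderivWithin ℝ (P.φ 0) (unitBall n) y v) = v := by
  refine ⟨fun y => (ContinuousLinearMap.fst ℝ (Par n) ℝ ∘L
    ContinuousLinearMap.proj (φ := fun _ : Fin 3 => Par n × ℝ) 0) ∘L
    (P.lin y).inverse ∘L ContinuousLinearMap.single ℝ (fun _ : Fin 3 => Amb n) 0, ?_, ?_⟩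
  · exact contDiffOn_const.clm_comp (P.contDiffOn_lin_inverse.clm_comp contDiffOn_const)
  · intro y hy v
    have h1 : (P.lin y) (Pi.single 0 (v, 0)) =
        Pi.single 0 (fderivWithin ℝ (P.φ 0) (unitBall n) y v) := by
      have h0 : (fun j => ((Pi.single 0 (v, 0) : Fin 3 → Par n × ℝ) j).2) = 0 := by
        funext j
        rcases eq_or_ne j 0 with rfl | hj
        · simp
        · simp [Pi.single_eq_of_ne hj]
      funext i
      rw [lin_apply, h0, Matrix.mulVec_zero]
      rcases eq_or_ne i 0 with rfl | hi
      · simp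
      · simp [Pi.single_eq_of_ne hi]
    simp only [ContinuousLinearMap.comp_apply, ContinuousLinearMap.single_apply, ← h1,
      (P.lin_isInvertible hy).inverse_apply_self]
    simp

theorem isCompact_Gam (P : Frame D) (i : Fin 3) : IsCompact (D.Gam i) := by
  rw [← (P.φ_bij i).image_eq]
  exact (isCompact_closedBall _ _).image_of_continuousOn (P.φ_smooth i).continuousOn

/-- The parameters of the nearest points on `Σ_*` are smooth functions of the parameters of the
points of the support of `τ_i`. They are cut off near the axis to be defined on the whole ball, with
values in the ball. -/
theorem exists_footPar (i : Fin 3) : ∃ q : Par n → Par n, ContDiffOn ℝ ∞ q (unitBall n) ∧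
    MapsTo q (unitBall n) (unitBall n) ∧
    ∀ y ∈ unitBall n, P.τ i (P.φ i y) ≠ 0 → ∀ j, P.φ j (q y) = D.pr (P.φ i y) := by
  obtain ⟨m, hm0, hm⟩ := (((P.isCompact_Gam i).closure_of_subset
    (s := {x | x ∈ D.Gam i ∧ P.τ i x ≠ 0}) fun x hx => hx.1)).exists_forall_le'
    (f := fun x => ‖D.planar x‖ ^ 2) (by
      have := D.contDiff_planar.continuous
      fun_prop) (a := 0)
    (fun x hx => by have := norm_pos_iff.2 (D.planar_ne_zero (P.τ_support i x hx)); positivity)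
  set w : Par n → ℝ := fun y => ‖D.planar (P.φ i y)‖ ^ 2 with hw
  have hwc : ContDiffOn ℝ ∞ w (unitBall n) :=
    (D.contDiff_planar.comp_contDiffOn (P.φ_smooth i)).norm_sq ℝ
  set V : Set (Par n) := {y | y ∈ unitBall n ∧ 0 < w y} with hV
  have hVne : ∀ y ∈ V, D.planar (P.φ i y) ≠ 0 := by
    intro y hy h
    have := hy.2
    simp [hw, h] at this
  have hVu : UniqueDiffOn ℝ V := by
    obtain ⟨O, hO, hVO⟩ := (continuousOn_iff'.1 hwc.continuousOn) (Ioi 0) isOpen_Ioi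
    have : V = unitBall n ∩ O := by
      rw [inter_comm, ← hVO]
      ext y
      exact and_comm
    rw [this]
    exact (uniqueDiffOn_unitBall n).inter hO
  have hex : ∀ y ∈ V, ∃ x ∈ Metric.sphere (0 : Par n) 1, P.φ 0 x = D.foot (P.φ i y) := by
    intro y hy
    have := D.foot_mem (hVne y hy)
    rwa [← P.φ_boundary 0] at this
  choose! q₀ hq₀ hφq₀ using hex
  have hq₀B : MapsTo q₀ V (unitBall n) := fun y hy => Metric.sphere_subset_closedBall (hq₀ y hy)
  obtain ⟨L, hL, hLφ⟩ := P.exists_leftInverse_fderivWithin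
  have hq₀c : ContDiffOn ℝ ∞ q₀ V := contDiffOn_lift hVu (isCompact_closedBall _ _)
    (P.φ_smooth 0) (P.φ_bij 0).injOn hL hLφ hq₀B
    (fun y hy => (D.contDiffAt_foot (hVne y hy)).comp_contDiffWithinAt y
      ((P.φ_smooth i).mono (fun _ h => h.1) y hy)) hφq₀
  let χ : ℝ → ℝ := fun t => Real.smoothTransition (2 * t / m - 1)
  have hχc : ContDiff ℝ ∞ χ := Real.smoothTransition.contDiff.comp (by fun_prop)
  have hχ0 : ∀ t, t ≤ m / 2 → χ t = 0 := fun t ht =>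
    Real.smoothTransition.zero_of_nonpos (by
      rw [sub_nonpos, div_le_one hm0]; linarith)
  have hχ1 : ∀ t, m ≤ t → χ t = 1 := fun t ht =>
    Real.smoothTransition.one_of_one_le (by
      rw [le_sub_iff_add_le, le_div_iff₀ hm0]; linarith)
  refine ⟨fun y => χ (w y) • q₀ y, fun y hy => ?_, fun y hy => ?_, fun y hy hτ j => ?_⟩
  · rcases lt_or_ge (w y) (m / 2) with h | h
    · have h1 : ∀ᶠ z in 𝓝[unitBall n] y, w z < m / 2 :=
        (hwc.continuousOn y hy).eventually_lt continuousWithinAt_const h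
      refine (contDiffWithinAt_const (c := (0 : Par n))).congr_of_eventuallyEq ?_ ?_
      · filter_upwards [h1] with z hz
        simp [hχ0 _ hz.le]
      · simp [hχ0 _ h.le]
    · have hyV : y ∈ V := ⟨hy, by linarith⟩
      have h1 : V ∈ 𝓝[unitBall n] y := by
        filter_upwards [eventually_mem_nhdsWithin, continuousWithinAt_const.eventually_lt
          (hwc.continuousOn y hy) hyV.2] with z hz hz' using ⟨hz, hz'⟩
      exact ((hχc.contDiffAt.comp_contDiffWithinAt y (hwc y hy)).smul
        ((hq₀c y hyV).mono_of_mem_nhdsWithin h1))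
  · rcases lt_or_ge (w y) (m / 2) with h | h
    · simp [hχ0 _ h.le]
    · have hyV : y ∈ V := ⟨hy, by linarith⟩
      have h1 : ‖q₀ y‖ = 1 := by simpa using hq₀ y hyV
      have h2 := Real.smoothTransition.nonneg (2 * w y / m - 1)
      have h3 := Real.smoothTransition.le_one (2 * w y / m - 1)
      simpa [norm_smul, h1, χ, abs_of_nonneg h2] using h3
  · have hmem : P.φ i y ∈ closure {x | x ∈ D.Gam i ∧ P.τ i x ≠ 0} :=
      subset_closure ⟨P.mem_Gam i hy, hτ⟩
    have h1 : m ≤ w y := hm _ hmem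
    have hyV : y ∈ V := ⟨hy, by linarith⟩
    simp only [hχ1 _ h1, one_smul]
    rw [P.φ_junction j 0 _ (hq₀ y hyV), hφq₀ y hyV, D.pr_eq_foot (P.τ_support i _ hmem)]

end Frame

/-! ### The perturbed equation -/

namespace Frame

variable {D : DoubleBubble n} (P : Frame D)

/-- The closed unit ball of the triples of functions in `C^k`, in the parametrizations. -/
def PullBall (n k : ℕ) : Type :=
  {g : Fin 3 → Par n → ℝ // ∀ j, ContDiffOn ℝ k (g j) (unitBall n) ∧
    ∀ l ≤ k, ∀ x ∈ unitBall n, ‖iteratedFDerivWithin ℝ l (g j) (unitBall n) x‖ ≤ 1}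

theorem unifCk_pullBall (k : ℕ) (j : Fin 3) :
    UnifCk k (fun g : PullBall n k => g.1 j) (unitBall n) :=
  ⟨fun g => (g.2 j).1, 1, fun g => (g.2 j).2⟩

/-- The displacement `g_i N_i + (𝒯 g ∘ q_i)_i τ_i` of the nonlocal description, for functions `g` in
the parametrizations. Here `q i` stands for the projection to `Σ_*` in the parametrizations, that
is, `φ_j (q_i (x))` is the nearest point to `φ_i (x)`. -/
def disp (q : Fin 3 → Par n → Par n) (g : Fin 3 → Par n → ℝ) (i : Fin 3) (x : Par n) : Amb n :=
  g i x • D.normal i (P.φ i x) + (D.T.mulVec (fun j => g j (q i x)) i) • P.τ i (P.φ i x)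

theorem disp_smul (q : Fin 3 → Par n → Par n) (g : Fin 3 → Par n → ℝ) (r : ℝ) (i : Fin 3)
    (x : Par n) : P.disp q (r • g) i x = r • P.disp q g i x := by
  have : D.T.mulVec (fun j => (r • g) j (q i x)) i = r * D.T.mulVec (fun j => g j (q i x)) i :=
    congrFun (D.T.mulVec_smul r (fun j => g j (q i x))) i
  rw [disp, disp, this, smul_add, smul_smul, smul_smul]
  rfl

theorem unifCk_disp {q : Fin 3 → Par n → Par n} (hq : ∀ i, ContDiffOn ℝ ∞ (q i) (unitBall n))
    (hqB : ∀ i, MapsTo (q i) (unitBall n) (unitBall n)) (k : ℕ) (i : Fin 3) :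
    UnifCk k (fun g : PullBall n k => P.disp q g.1 i) (unitBall n) := by
  have hu := uniqueDiffOn_unitBall n
  have hc : IsCompact (unitBall n) := isCompact_closedBall _ _
  have hk : (k : ℕ∞ω) ≤ ∞ := by exact_mod_cast le_top
  have h1 (j : Fin 3) : UnifCk k (fun (g : PullBall n k) x => g.1 j (q i x)) (unitBall n) :=
    (unifCk_pullBall k j).comp (.const hu hc ((hq i).of_le hk)) hu hu fun _ => hqB i
  have h2 : UnifCk k (fun (g : PullBall n k) x => D.T.mulVec (fun j => g.1 j (q i x)) i)
      (unitBall n) :=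
    (UnifCk.sum Finset.univ hu fun j _ =>
      (h1 j).clm_comp (D.T i j • ContinuousLinearMap.id ℝ ℝ) hu).congr fun g x _ => by
        simp [Matrix.mulVec, dotProduct]
  exact ((unifCk_pullBall k i).bilin (ContinuousLinearMap.lsmul ℝ ℝ) hu
    (.const hu hc ((P.contDiffOn_normal_φ i).of_le hk))).add hu
    (h2.bilin (ContinuousLinearMap.lsmul ℝ ℝ) hu (.const hu hc ((P.τ_smooth i).of_le hk)))

/-- The contribution of `g` to the Newton map of the perturbed equation. -/
def pert (q : Fin 3 → Par n → Par n) (g : Fin 3 → Par n → ℝ)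
    (p : Par n × (Fin 3 → Par n × ℝ)) : Fin 3 → Par n × ℝ :=
  -(P.lin p.1).inverse fun i => P.disp q g i (p.1 + (p.2 i).1)

theorem unifCk_pert {q : Fin 3 → Par n → Par n} (hq : ∀ i, ContDiffOn ℝ ∞ (q i) (unitBall n))
    (hqB : ∀ i, MapsTo (q i) (unitBall n) (unitBall n)) (k : ℕ) :
    UnifCk k (fun g : PullBall n k => P.pert q g.1) (displDom (Par n) (Fin 3)) := by
  have hu := uniqueDiffOn_displDom (X := Par n) (κ := Fin 3)
  have hc := isCompact_displDom (X := Par n) (κ := Fin 3)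
  have hk : (k : ℕ∞ω) ≤ ∞ := by exact_mod_cast le_top
  have h1 (i : Fin 3) : UnifCk k (fun (g : PullBall n k) (p : Par n × (Fin 3 → Par n × ℝ)) =>
      P.disp q g.1 i (p.1 + (p.2 i).1)) (displDom (Par n) (Fin 3)) :=
    (P.unifCk_disp hq hqB k i).comp (.const hu hc (by fun_prop)) (uniqueDiffOn_unitBall n) hu
      fun _ => mapsTo_displ i
  have h2 : UnifCk k (fun (g : PullBall n k) (p : Par n × (Fin 3 → Par n × ℝ)) i =>
      P.disp q g.1 i (p.1 + (p.2 i).1)) (displDom (Par n) (Fin 3)) := UnifCk.pi hu h1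
  have h3 : UnifCk k (fun (_ : PullBall n k) (p : Par n × (Fin 3 → Par n × ℝ)) =>
      (P.lin p.1).inverse) (displDom (Par n) (Fin 3)) :=
    .const hu hc ((P.contDiffOn_lin_inverse.comp contDiff_fst.contDiffOn
      mapsTo_fst_displDom).of_le hk)
  exact h3.bilin (-ContinuousLinearMap.id ℝ ((Fin 3 → Amb n) →L[ℝ] (Fin 3 → Par n × ℝ))) hu h2

/-- The fixed points of the Newton map solve the equation which says that the points at parameter
`y + ξ_i` of the nonlocal description are those at parameter `y` of the local one. -/
theorem newton_add_pert_eq_iff (q : Fin 3 → Par n → Par n) (g : Fin 3 → Par n → ℝ) (r : ℝ)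
    {y : Par n} (hy : y ∈ unitBall n) (Z : Fin 3 → Par n × ℝ) :
    P.newton (y, Z) + r • P.pert q g (y, Z) = Z ↔
      ∀ i, P.φ i (y + (Z i).1) + r • P.disp q g i (y + (Z i).1) =
        P.φ i y + (Z i).2 • D.normal i (P.φ i y)
          + (D.T.mulVec (fun j => (Z j).2) i) • P.τ i (P.φ i y) := by
  have hinj := (P.lin_isInvertible hy).inverse.injective
  have h1 : P.newton (y, Z) + r • P.pert q g (y, Z) = Z - (P.lin y).inverse
      (P.resid (y, Z) + r • fun i => P.disp q g i (y + (Z i).1)) := by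
    rw [map_add, map_smul, newton, pert, smul_neg]
    abel
  rw [h1, sub_eq_self, map_eq_zero_iff _ hinj, funext_iff]
  refine forall_congr' fun i => ?_
  rw [← sub_eq_zero (a := P.φ i (y + (Z i).1) + _)]
  simp only [resid, Pi.add_apply, Pi.smul_apply, Pi.zero_apply]
  rw [sub_add_eq_add_sub]

/-! ### Functions on the hypersurfaces and their parametrizations -/

theorem val_coe (ρ : D.Fun) (i : Fin 3) (σ : D.Gam i) : D.val ρ i σ.1 = ρ i σ :=
  Subtype.val_injective.extend_apply _ _ _

theorem φInv_φ (i : Fin 3) {y : Par n} (hy : y ∈ unitBall n) : P.φInv i (P.φ i y) = y :=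
  (P.φ_bij i).injOn.leftInvOn_invFunOn hy

theorem pull_apply (ρ : D.Fun) (i : Fin 3) {y : Par n} (hy : y ∈ unitBall n) :
    P.pull ρ i y = ρ i ⟨P.φ i y, P.mem_Gam i hy⟩ :=
  val_coe ρ i ⟨P.φ i y, P.mem_Gam i hy⟩

theorem exists_param {i : Fin 3} (σ : D.Gam i) :
    ∃ y, ∃ hy : y ∈ unitBall n, σ = ⟨P.φ i y, P.mem_Gam i hy⟩ := by
  obtain ⟨y, hy, h⟩ := (P.φ_bij i).surjOn σ.2
  exact ⟨y, hy, Subtype.ext h.symm⟩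

theorem norm_iteratedFDerivWithin_pull_le {k : ℕ} {ρ : D.Fun} (hρ : ρ ∈ P.CkTJ k) (i : Fin 3)
    {l : ℕ} (hl : l ≤ k) {x : Par n} (hx : x ∈ unitBall n) :
    ‖iteratedFDerivWithin ℝ l (P.pull ρ i) (unitBall n) x‖ ≤ P.normCk k ρ := by
  obtain ⟨C, hC⟩ := (isCompact_closedBall (0 : Par n) 1).exists_bound_of_continuousOn
    ((hρ i).continuousOn_iteratedFDerivWithin (m := l) (by exact_mod_cast hl)
      (uniqueDiffOn_unitBall n))
  have h0 (i : Fin 3) (j : ℕ) :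
      0 ≤ ⨆ x : unitBall n, ‖iteratedFDerivWithin ℝ j (P.pull ρ i) (unitBall n) x.1‖ :=
    Real.iSup_nonneg fun _ => norm_nonneg _
  calc _ ≤ ⨆ x : unitBall n, ‖iteratedFDerivWithin ℝ l (P.pull ρ i) (unitBall n) x.1‖ :=
        le_ciSup (f := fun x : unitBall n =>
          ‖iteratedFDerivWithin ℝ l (P.pull ρ i) (unitBall n) x.1‖)
          ⟨C, by rintro _ ⟨x, rfl⟩; exact hC x.1 x.2⟩ ⟨x, hx⟩
    _ ≤ _ := Finset.single_le_sum (f := fun j => ⨆ x : unitBall n,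
          ‖iteratedFDerivWithin ℝ j (P.pull ρ i) (unitBall n) x.1‖) (fun j _ => h0 i j)
          (Finset.mem_range.2 (by omega))
    _ ≤ _ := Finset.single_le_sum (f := fun i => ∑ j ∈ Finset.range (k + 1), ⨆ x : unitBall n,
          ‖iteratedFDerivWithin ℝ j (P.pull ρ i) (unitBall n) x.1‖)
          (fun i _ => Finset.sum_nonneg fun j _ => h0 i j) (Finset.mem_univ i)

theorem normCk_le {k : ℕ} {ρ : D.Fun} {C : ℝ} (hC : 0 ≤ C)
    (h : ∀ i, ∀ l ≤ k, ∀ x ∈ unitBall n,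
      ‖iteratedFDerivWithin ℝ l (P.pull ρ i) (unitBall n) x‖ ≤ C) :
    P.normCk k ρ ≤ 3 * ((k + 1) * C) := by
  calc P.normCk k ρ ≤ ∑ _i : Fin 3, ∑ _j ∈ Finset.range (k + 1), C :=
        Finset.sum_le_sum fun i _ => Finset.sum_le_sum fun j hj =>
          Real.iSup_le (fun x => h i j (by have := Finset.mem_range.1 hj; omega) x.1 x.2) hC
    _ = _ := by simp

/-- The functions of the ball of radius `r`, divided by `r`, in the parametrizations. -/
def scaledPull {k : ℕ} {r : ℝ} (hr : 0 < r) (ρ : P.ball k r) : PullBall n k :=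
  ⟨r⁻¹ • P.pull ρ.1, fun j => ⟨(ρ.2.1 j).const_smul r⁻¹, fun l hl x hx => by
    rw [Pi.smul_apply, iteratedFDerivWithin_const_smul_apply
      ((ρ.2.1 j x hx).of_le (by exact_mod_cast hl)) (uniqueDiffOn_unitBall n) hx, norm_smul,
      norm_inv, Real.norm_of_nonneg hr.le, inv_mul_le_one₀ hr]
    exact (P.norm_iteratedFDerivWithin_pull_le ρ.2.1 j hl hx).trans ρ.2.2.le⟩⟩

theorem Phi_muDGK {q : Fin 3 → Par n → Par n}
    (hqφ : ∀ i, ∀ y ∈ unitBall n, P.τ i (P.φ i y) ≠ 0 → ∀ j, P.φ j (q i y) = D.pr (P.φ i y))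
    (ρ : D.Fun) (i : Fin 3) {x : Par n} (hx : x ∈ unitBall n) :
    P.Phi ρ (D.muDGK ρ) i ⟨P.φ i x, P.mem_Gam i hx⟩ = P.φ i x + P.disp q (P.pull ρ) i x := by
  rw [Phi, disp, P.pull_apply ρ i hx, ← add_assoc]
  congr 1
  by_cases hτ : P.τ i (P.φ i x) = 0
  · simp [hτ]
  · congr 2
    rw [DoubleBubble.muDGK]
    congr 1
    funext j
    rw [pull, hqφ i x hx hτ j]

theorem Phi_muG (ρ : D.Fun) (i : Fin 3) {y : Par n} (hy : y ∈ unitBall n) :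
    P.Phi ρ (P.muG ρ) i ⟨P.φ i y, P.mem_Gam i hy⟩ =
      P.φ i y + P.pull ρ i y • D.normal i (P.φ i y)
        + (D.T.mulVec (fun j => P.pull ρ j y) i) • P.τ i (P.φ i y) := by
  rw [Phi, muG, P.φInv_φ i hy, P.pull_apply ρ i hy]

/-- On the sphere the equation is solved without moving the parameters: the projection to `Σ_*` is
the identity there, and the parametrizations agree. -/
theorem newton_add_pert_boundary {q : Fin 3 → Par n → Par n}
    (hqB : ∀ i, MapsTo (q i) (unitBall n) (unitBall n))
    (hqφ : ∀ i, ∀ y ∈ unitBall n, P.τ i (P.φ i y) ≠ 0 → ∀ j, P.φ j (q i y) = D.pr (P.φ i y))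
    (g : Fin 3 → Par n → ℝ) (r : ℝ) {y : Par n} (hy : y ∈ Metric.sphere (0 : Par n) 1) :
    P.newton (y, r • fun i => (0, g i y)) + r • P.pert q g (y, r • fun i => (0, g i y)) =
      r • fun i => (0, g i y) := by
  have hyB : y ∈ unitBall n := Metric.sphere_subset_closedBall hy
  rw [P.newton_add_pert_eq_iff q g r hyB]
  intro i
  have h1 : y + ((r • fun i => ((0 : Par n), g i y)) i).1 = y := by simp
  rw [h1, ← disp_smul, add_assoc]
  congr 1
  rw [disp]
  congr 1
  by_cases hτ : P.τ i (P.φ i y) = 0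
  · simp [hτ]
  · have h2 : q i y = y := by
      refine (P.φ_bij i).injOn (hqB i hyB) hyB ?_
      rw [hqφ i y hyB hτ i]
      exact D.pr_of_mem_Sig (by rw [← P.φ_boundary i]; exact mem_image_of_mem _ hy)
    rw [h2]
    rfl

/-- The correction that has to be added to `ρ` to obtain the triple of functions on the hypersurfaces
which is given by `u` in the parametrizations. -/
def corr (u : Par n → Fin 3 → ℝ) (ρ : D.Fun) : D.Fun := fun i σ => u (P.φInv i σ.1) i - ρ i σ

theorem pull_corr (u : Par n → Fin 3 → ℝ) (ρ : D.Fun) (i : Fin 3) {y : Par n}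
    (hy : y ∈ unitBall n) : P.pull (P.corr u ρ) i y = u y i - P.pull ρ i y := by
  rw [P.pull_apply _ i hy, P.pull_apply _ i hy, corr, P.φInv_φ i hy]

theorem pull_add_corr (u : Par n → Fin 3 → ℝ) (ρ : D.Fun) (i : Fin 3) {y : Par n}
    (hy : y ∈ unitBall n) : P.pull (ρ + P.corr u ρ) i y = u y i := by
  rw [P.pull_apply _ i hy, Pi.add_apply, Pi.add_apply, corr, P.φInv_φ i hy]
  ring

/-- The clusters agree if the equation holds and the maps `y ↦ y + ξ_i(y)` are onto the ball. -/
theorem cluster_eq {q : Fin 3 → Par n → Par n}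
    (hqφ : ∀ i, ∀ y ∈ unitBall n, P.τ i (P.φ i y) ≠ 0 → ∀ j, P.φ j (q i y) = D.pr (P.φ i y))
    {ρ : D.Fun} {Z : Par n → Fin 3 → Par n × ℝ}
    (hZ : ∀ y ∈ unitBall n, ∀ i, y + (Z y i).1 ∈ unitBall n ∧
      P.φ i (y + (Z y i).1) + P.disp q (P.pull ρ) i (y + (Z y i).1) =
        P.φ i y + (Z y i).2 • D.normal i (P.φ i y)
          + (D.T.mulVec (fun j => (Z y j).2) i) • P.τ i (P.φ i y))
    (hsurj : ∀ i, ∀ x ∈ unitBall n, ∃ y ∈ unitBall n, y + (Z y i).1 = x) :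
    P.cluster ρ (D.muDGK ρ) = P.cluster (ρ + P.corr (fun y i => (Z y i).2) ρ)
      (P.muG (ρ + P.corr (fun y i => (Z y i).2) ρ)) := by
  set ρ' := ρ + P.corr (fun y i => (Z y i).2) ρ with hρ'
  have key : ∀ i, ∀ y, ∀ hy : y ∈ unitBall n, P.Phi ρ' (P.muG ρ') i ⟨P.φ i y, P.mem_Gam i hy⟩ =
      P.Phi ρ (D.muDGK ρ) i ⟨P.φ i (y + (Z y i).1), P.mem_Gam i (hZ y hy i).1⟩ := by
    intro i y hy
    rw [P.Phi_muG ρ' i hy, P.Phi_muDGK hqφ ρ i (hZ y hy i).1, (hZ y hy i).2]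
    simp only [hρ', P.pull_add_corr _ ρ _ hy]
  funext i
  refine Subset.antisymm ?_ ?_
  · rintro _ ⟨σ, rfl⟩
    obtain ⟨x, hx, rfl⟩ := P.exists_param σ
    obtain ⟨y, hy, rfl⟩ := hsurj i x hx
    exact ⟨_, key i y hy⟩
  · rintro _ ⟨σ, rfl⟩
    obtain ⟨y, hy, rfl⟩ := P.exists_param σ
    exact ⟨_, (key i y hy).symm⟩

theorem norm_pullBall_le {k : ℕ} (g : PullBall n k) (i : Fin 3) {y : Par n}
    (hy : y ∈ unitBall n) : ‖g.1 i y‖ ≤ 1 := by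
  simpa using (g.2 i).2 0 (Nat.zero_le _) y hy

end Frame

end TripleJunction

end

open TripleJunction Frame Set in
theorem mainTheorem9 (n : ℕ) (hn : 1 ≤ n) (D : TripleJunction.DoubleBubble n)
    (P : TripleJunction.Frame D) (k : ℕ) (hk : 2 ≤ k) :
    ∃ r r' : ℝ, 0 < r ∧ 0 < r' ∧ ∃ Fbar : P.ball k r → P.ball0 k r',
      ∀ ρ : P.ball k r,
        P.cluster ρ.1 (D.muDGK ρ.1) =
          P.cluster (ρ.1 + (Fbar ρ).1) (P.muG (ρ.1 + (Fbar ρ).1)) := by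
  obtain ⟨m, rfl⟩ : ∃ m, k = m + 1 := ⟨k - 1, by omega⟩
  have : Nonempty (Fin n) := ⟨⟨0, hn⟩⟩
  have hu := uniqueDiffOn_unitBall n
  choose q hq hqB hqφ using P.exists_footPar
  obtain ⟨r, hr, Z, hZ, hsurj, hZb, hZC⟩ := exists_fixedPoint_perturbation
    (b := fun (g : PullBall n (m + 1)) y i => ((0 : Par n), g.1 i y)) P.contDiffOn_newton
    (fun y _ => P.newton_zero y) (fun y hy => P.hasFDerivWithinAt_newton hy)
    (P.unifCk_pert hq hqB (m + 1)) fun g y hy =>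
      ⟨(pi_norm_le_iff_of_nonneg zero_le_one).2 fun i => by
        simpa [Prod.norm_def] using norm_pullBall_le g i (Metric.sphere_subset_closedBall hy),
        fun _ => rfl, fun r _ _ => P.newton_add_pert_boundary hqB hqφ g.1 r hy⟩
  have hpull (ρ : P.ball (m + 1) r) : P.pull ρ.1 = r • (P.scaledPull hr ρ).1 :=
    (smul_inv_smul₀ hr.ne' _).symm
  -- The normal components minus `ρ`, in the parametrizations, are bounded in `C^k`.
  have hU (i : Fin 3) : UnifCk (m + 1)
      (fun (g : PullBall n (m + 1)) y => (Z g y i).2 - (r • g.1) i y) (unitBall n) :=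
    ((hZC.clm_comp (ContinuousLinearMap.snd ℝ (Par n) ℝ ∘L ContinuousLinearMap.proj i) hu).add hu
      ((unifCk_pullBall (m + 1) i).clm_comp (-r • ContinuousLinearMap.id ℝ ℝ) hu)).congr
      fun g y _ => by simp [sub_eq_add_neg]
  choose C hC1 hC using fun i => (hU i).exists_pos_bound
  set M := ∑ i, C i
  have hCM (i : Fin 3) : C i ≤ M :=
    Finset.single_le_sum (fun i _ => zero_le_one.trans (hC1 i)) (Finset.mem_univ i)
  have hM : 0 ≤ M := zero_le_one.trans ((hC1 0).trans (hCM 0))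
  let F (ρ : P.ball (m + 1) r) : D.Fun :=
    P.corr (fun y i => (Z (P.scaledPull hr ρ) y i).2) ρ.1
  have hF (ρ : P.ball (m + 1) r) (i : Fin 3) : EqOn (P.pull (F ρ) i)
      (fun y => (Z (P.scaledPull hr ρ) y i).2 - (r • (P.scaledPull hr ρ).1) i y) (unitBall n) := by
    intro y hy
    simp only [F, P.pull_corr _ _ i hy, ← hpull]
  have hF0 (ρ : P.ball (m + 1) r) : F ρ ∈ P.ball0 (m + 1) (3 * (((m + 1 : ℕ) + 1) * M) + 1) := by
    refine ⟨⟨fun i => ?_, fun i σ hσ => ?_⟩, ?_⟩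
    · exact ((hU i).1 _).congr (hF ρ i)
    · rw [← P.φ_boundary i] at hσ
      obtain ⟨y, hy, hyσ⟩ := hσ
      have hyB : y ∈ unitBall n := Metric.sphere_subset_closedBall hy
      obtain rfl : σ = ⟨P.φ i y, P.mem_Gam i hyB⟩ := Subtype.ext hyσ.symm
      rw [← P.pull_apply (F ρ) i hyB, hF ρ i hyB]
      simp [hZb _ y hy]
    · refine (P.normCk_le hM fun i l hl x hx => ?_).trans_lt (lt_add_one _)
      rw [iteratedFDerivWithin_congr (hF ρ i) hx]
      exact (hC i _ l hl x hx).trans (hCM i)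
  refine ⟨r, _, hr, by positivity, fun ρ => ⟨F ρ, hF0 ρ⟩, fun ρ => ?_⟩
  refine P.cluster_eq hqφ (fun y hy i => ⟨(hZ _ y hy).1.2.1 i, ?_⟩) fun i => hsurj _ i
  have := (P.newton_add_pert_eq_iff q _ r hy _).1 (hZ (P.scaledPull hr ρ) y hy).2 i
  rwa [← disp_smul, ← hpull] at this
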